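/- Let $L$ be a Lévy process in $\mathbb R^d$ with characteristics $(b,\sigma,F)$ with respect to a truncation function $h$. That is, $b\in\mathbb R^d$; $\sigma$ is a symmetric positive semidefinite $d\times d$ matrix; $F$ is a Borel measure with $\int(|x|^2\wedge1)\,F(dx)<\infty$; $h:\mathbb R^d\to\mathbb R^d$ is measurable with $h(x)=x$ near $0$ and such that the following integrands are $F$-integrable for every $\xi$ (for instance, $h$ bounded); and $$E\,e^{i\langle\xi,L_t\rangle}=\exp\Big(t\Big[-\tfrac12\langle\xi,\sigma\xi\rangle+i\langle\xi,b\rangle+\int\big(e^{i\langle\xi,y\rangle}-1-i\langle\xi,h(y)\rangle\big)F(dy)\Big]\Big)\qquad(t\ge0,\ \xi\in\mathbb R^d).$$ Let $$A(\xi)=\tfrac12\langle\xi,\sigma\xi\rangle+i\langle\xi,b\rangle-\int\big(e^{-i\langle\xi,y\rangle}-1+i\langle\xi,h(y)\rangle\big)F(dy)$$ be the symbol of $L$, and let $\mathcal A=-\mathcal G$, where $$\mathcal G u(x)=\tfrac12\sum_{j,k}\sigma^{jk}\,\partial_j\partial_k u(x)+\sum_j b^j\,\partial_j u(x)+\int\Big(u(x+y)-u(x)-\sum_j\partial_ju(x)\,h(y)_j\Big)F(dy).$$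 Let $H^{\Re(A)}$ be the real Hilbert space obtained by completing $C_0^\infty(\mathbb R^d,\mathbb R)$ with respect to the norm $$\|u\|_{\Re(A)}=\Big(\int_{\mathbb R^d}\big(1+\Re A(\xi)\big)|\hat u(\xi)|^2\,d\xi\Big)^{1/2},\qquad \hat u(\xi)=\int e^{i\langle\xi,x\rangle}u(x)\,dx,$$ with its canonical embedding into the real space $L^2(\mathbb R^d)$, and consider the Gelfand triplet $H^{\Re(A)}\hookrightarrow L^2(\mathbb R^d)\hookrightarrow (H^{\Re(A)})^*$. Assume that there is a constant $c\ge0$ with $$|\Im A(\xi)|\le c\,(1+\Re A(\xi))\qquad\text{for all }\xi\in\mathbb R^d .$$ Then the following hold. 1. (Continuity) The bilinear form $a(u,v)=\int(\mathcal A u)(x)\,v(x)\,dx$ on $C_0^\infty(\mathbb R^d,\mathbb R)$ satisfies $|a(u,v)|\le C\|u\|_{\Re(A)}\|v\|_{\Re(A)}$ for some constant $C$. Hence it extends uniquely to a continuous bilinear form $a$ on $H^{\Re(A)}$. 2. (Gårding inequality) There are constants $c_2>0$ and $c_3\ge0$ with $a(u,u)\ge c_2\|u\|_{\Re(A)}^2-c_3\|u\|_{L^2}^2$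 for all $u\in H^{\Re(A)}$. 3. (Parabolic equation) Let $T>0$, $f\in L^2(0,T;(H^{\Re(A)})^*)$ and $g\in L^2(\mathbb R^d)$, and let $\mathcal A:H^{\Re(A)}\to (H^{\Re(A)})^*$ also denote the operator $(\mathcal A u)(v)=a(u,v)$. Then the equation $$\dot u+\mathcal A u=f,\qquad u(0)=g$$ has a unique solution $u\in W^1(0,T;H^{\Re(A)},L^2(\mathbb R^d))$. Here $W^1(0,T;V,H)$ is the space of all $u\in L^2(0,T;V)$ whose distributional time derivative $\dot u$ belongs to $L^2(0,T;V^*)$. The equation holds in $(H^{\Re(A)})^*$ for almost every $t\in(0,T)$, and $u(0)=g$ means that $u$ has a representative in $C([0,T];L^2(\mathbb R^d))$ with value $g$ at $t=0$. -/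

import Mathlib

open MeasureTheory ProbabilityTheory Filter Topology
open scoped NNReal ENNReal InnerProductSpace Distributions FourierTransform

noncomputable section

/-! ## Lévy processes and their characteristics -/

/-- `L` is a Lévy process with values in `ℝ^d` on the probability space `(Ω, P)`. -/
structure IsLevyProcess {d : ℕ} {Ω : Type*} [MeasurableSpace Ω]
    (L : ℝ≥0 → Ω → EuclideanSpace ℝ (Fin d)) (P : Measure Ω) : Prop where
  measurable : ∀ t, Measurable (L t)
  zero : ∀ᵐ ω ∂P, L 0 ω = 0
  indep_increments : HasIndepIncrements L P
  stationary_increments : ∀ s t, IdentDistrib (fun ω => L (s + t) ω - L s ω) (L t) P P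
  continuous_in_probability : ∀ t, TendstoInMeasure P L (𝓝 t) (L t)
  cadlag : ∀ᵐ ω ∂P, ∀ t, ContinuousWithinAt (fun s => L s ω) (Set.Ici t) t ∧
    ∃ l, Tendsto (fun s => L s ω) (𝓝[<] t) (𝓝 l)

/-- Characteristics `(b, σ, F)` with respect to a truncation function `h` on `ℝ^d`: a vector, a
symmetric positive semidefinite matrix and a Lévy measure.  The truncation function equals the
identity near `0`; it is not required to be bounded, only to be such that the integrand of the
Lévy-Khintchine formula is integrable (which is automatic when `h` is bounded). -/
structure LevyCharacteristics (d : ℕ) where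
  b : EuclideanSpace ℝ (Fin d)
  σ : Matrix (Fin d) (Fin d) ℝ
  F : Measure (EuclideanSpace ℝ (Fin d))
  h : EuclideanSpace ℝ (Fin d) → EuclideanSpace ℝ (Fin d)
  posSemidef_σ : σ.PosSemidef
  levyMeasure_F : ∫⁻ x, ENNReal.ofReal (min (‖x‖ ^ 2) 1) ∂F < ∞
  measurable_h : Measurable h
  h_eq_id : ∀ᶠ x in 𝓝 0, h x = x
  integrable_h : ∀ ξ : EuclideanSpace ℝ (Fin d),
    Integrable (fun y => Complex.exp (Complex.I * (⟪ξ, y⟫_ℝ : ℝ)) - 1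
      - Complex.I * (⟪ξ, h y⟫_ℝ : ℝ)) F

namespace LevyCharacteristics

variable {d : ℕ} (χ : LevyCharacteristics d)

/-- `ξ ↦ θ(iξ) = - ½⟨ξ, σ ξ⟩ + i⟨ξ, b⟩ + ∫ (e^{i⟨ξ, y⟩} - 1 - i⟨ξ, h(y)⟩) F(dy)`. -/
def cumulant (ξ : EuclideanSpace ℝ (Fin d)) : ℂ :=
  -(1 / 2 : ℂ) * ((∑ j, ∑ k, ξ j * χ.σ j k * ξ k : ℝ) : ℂ) + Complex.I * (⟪ξ, χ.b⟫_ℝ : ℝ)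
    + ∫ y, (Complex.exp (Complex.I * (⟪ξ, y⟫_ℝ : ℝ)) - 1
        - Complex.I * (⟪ξ, χ.h y⟫_ℝ : ℝ)) ∂χ.F

/-- `χ` are the characteristics of the process `L` under `P`: `E e^{i⟨ξ, L_t⟩} = e^{t θ(iξ)}`. -/
def IsCharacteristicsOf {Ω : Type*} [MeasurableSpace Ω]
    (L : ℝ≥0 → Ω → EuclideanSpace ℝ (Fin d)) (P : Measure Ω) : Prop :=
  ∀ (t : ℝ≥0) (ξ : EuclideanSpace ℝ (Fin d)),
    ∫ ω, Complex.exp (Complex.I * (⟪ξ, L t ω⟫_ℝ : ℝ)) ∂P = Complex.exp ((t : ℂ) * χ.cumulant ξ)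

/-- The symbol
`A(ξ) = ½⟨ξ, σ ξ⟩ + i⟨ξ, b⟩ - ∫ (e^{-i⟨ξ, y⟩} - 1 + i⟨ξ, h(y)⟩) F(dy)`. -/
def symbol (ξ : EuclideanSpace ℝ (Fin d)) : ℂ :=
  (1 / 2 : ℂ) * ((∑ j, ∑ k, ξ j * χ.σ j k * ξ k : ℝ) : ℂ) + Complex.I * (⟪ξ, χ.b⟫_ℝ : ℝ)
    - ∫ y, (Complex.exp (-Complex.I * (⟪ξ, y⟫_ℝ : ℝ)) - 1
        + Complex.I * (⟪ξ, χ.h y⟫_ℝ : ℝ)) ∂χ.F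

/-- The symbol is `-θ(-iξ)`. -/
theorem symbol_eq (ξ : EuclideanSpace ℝ (Fin d)) : χ.symbol ξ = -χ.cumulant (-ξ) := by
  simp only [symbol, cumulant, inner_neg_left, PiLp.neg_apply, neg_mul, mul_neg, neg_neg,
    Complex.ofReal_neg, sub_neg_eq_add]
  ring

end LevyCharacteristics

/-! ## The integro-differential operator -/

/-- The partial derivative `∂f/∂x_j`. -/
def partialDeriv {d : ℕ} (j : Fin d) (f : EuclideanSpace ℝ (Fin d) → ℝ)
    (x : EuclideanSpace ℝ (Fin d)) : ℝ :=
  fderiv ℝ f x (EuclideanSpace.single j 1)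

namespace LevyCharacteristics

variable {d : ℕ} (χ : LevyCharacteristics d)

/-- The infinitesimal generator `𝒢`, as an integro-differential operator. -/
def generator (f : EuclideanSpace ℝ (Fin d) → ℝ) (x : EuclideanSpace ℝ (Fin d)) : ℝ :=
  (1 / 2) * ∑ j, ∑ k, χ.σ j k * partialDeriv j (partialDeriv k f) x
    + ∑ j, χ.b j * partialDeriv j f x
    + ∫ y, (f (x + y) - f x - ∑ j, partialDeriv j f x * χ.h y j) ∂χ.F

/-- The operator `𝒜 = -𝒢`. -/
def operator (f : EuclideanSpace ℝ (Fin d) → ℝ) (x : EuclideanSpace ℝ (Fin d)) : ℝ :=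
  -χ.generator f x

/-! ## The energy space `H^{Re A}` -/

theorem symbol_re (ξ : EuclideanSpace ℝ (Fin d)) :
    (χ.symbol ξ).re = (1 / 2) * (∑ j, ∑ k, ξ j * χ.σ j k * ξ k)
      + ∫ y, (1 - Real.cos ⟪ξ, y⟫_ℝ) ∂χ.F := by
  have hint : Integrable (fun y => Complex.exp (-Complex.I * (⟪ξ, y⟫_ℝ : ℝ)) - 1
        + Complex.I * (⟪ξ, χ.h y⟫_ℝ : ℝ)) χ.F := by
    refine (χ.integrable_h (-ξ)).congr (Eventually.of_forall fun y => ?_)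
    simp
  have h1 := integral_re hint
  have h2 : ∀ y, RCLike.re (Complex.exp (-Complex.I * (⟪ξ, y⟫_ℝ : ℝ)) - 1
        + Complex.I * (⟪ξ, χ.h y⟫_ℝ : ℝ)) = -(1 - Real.cos ⟪ξ, y⟫_ℝ) := by
    intro y
    simp [Complex.exp_re]
  simp only [h2, integral_neg] at h1
  have h3 : ∀ z : ℂ, RCLike.re z = z.re := fun _ => rfl
  rw [h3] at h1
  have h4 : ((1 / 2 : ℂ) * ((∑ j, ∑ k, ξ j * χ.σ j k * ξ k : ℝ) : ℂ)).re
      = (1 / 2) * (∑ j, ∑ k, ξ j * χ.σ j k * ξ k) := by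
    rw [show (1 / 2 : ℂ) = ((1 / 2 : ℝ) : ℂ) by push_cast; rfl, Complex.re_ofReal_mul,
      Complex.ofReal_re]
  rw [symbol, Complex.sub_re, ← h1, Complex.add_re, h4]
  simp

theorem one_sub_cos_nonneg (t : ℝ) : 0 ≤ 1 - Real.cos t := by
  linarith [Real.cos_le_one t]

theorem one_sub_cos_inner_le (ξ y : EuclideanSpace ℝ (Fin d)) :
    1 - Real.cos ⟪ξ, y⟫_ℝ ≤ (2 + ‖ξ‖ ^ 2) * min (‖y‖ ^ 2) 1 := by
  have h1 := Real.one_sub_sq_div_two_le_cos (x := ⟪ξ, y⟫_ℝ)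
  have h2 := Real.neg_one_le_cos ⟪ξ, y⟫_ℝ
  have h3 : ⟪ξ, y⟫_ℝ ^ 2 ≤ ‖ξ‖ ^ 2 * ‖y‖ ^ 2 := by
    rw [← mul_pow, ← sq_abs]
    gcongr
    exact abs_real_inner_le_norm ξ y
  rcases le_total (‖y‖ ^ 2) 1 with h | h
  · rw [min_eq_left h]
    nlinarith [sq_nonneg ‖y‖, sq_nonneg ‖ξ‖, mul_nonneg (sq_nonneg ‖ξ‖) (sq_nonneg ‖y‖)]
  · rw [min_eq_right h]
    nlinarith [sq_nonneg ‖ξ‖]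

theorem integrable_min : Integrable (fun y => min (‖y‖ ^ 2) 1) χ.F := by
  refine ⟨by fun_prop, ?_⟩
  rw [hasFiniteIntegral_iff_ofReal (Eventually.of_forall fun y => by positivity)]
  exact χ.levyMeasure_F

theorem symbol_re_nonneg (ξ : EuclideanSpace ℝ (Fin d)) : 0 ≤ (χ.symbol ξ).re := by
  rw [symbol_re]
  have h1 : 0 ≤ ∑ j, ∑ k, ξ j * χ.σ j k * ξ k := by
    have := χ.posSemidef_σ.dotProduct_mulVec_nonneg (ξ : Fin d → ℝ)
    simp only [dotProduct, Matrix.mulVec, Finset.mul_sum, star_trivial] at this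
    simpa [mul_assoc] using this
  have h2 : 0 ≤ ∫ y, (1 - Real.cos ⟪ξ, y⟫_ℝ) ∂χ.F :=
    integral_nonneg fun y => one_sub_cos_nonneg _
  positivity

theorem continuous_symbol_re : Continuous fun ξ => (χ.symbol ξ).re := by
  simp only [symbol_re]
  refine Continuous.add (by fun_prop) ?_
  rw [continuous_iff_continuousAt]
  intro ξ₀
  refine continuousAt_of_dominated
    (bound := fun y => (2 + (‖ξ₀‖ + 1) ^ 2) * min (‖y‖ ^ 2) 1) ?_ ?_ ?_ ?_
  · exact Eventually.of_forall fun ξ => by fun_prop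
  · filter_upwards [Metric.ball_mem_nhds ξ₀ one_pos] with ξ hξ
    refine Eventually.of_forall fun y => ?_
    have hn : ‖ξ‖ ≤ ‖ξ₀‖ + 1 := by
      have := norm_le_norm_add_norm_sub' ξ ξ₀
      rw [Metric.mem_ball, dist_eq_norm] at hξ
      linarith
    rw [Real.norm_of_nonneg (one_sub_cos_nonneg _)]
    refine (one_sub_cos_inner_le ξ y).trans ?_
    gcongr
  · exact χ.integrable_min.const_mul _
  · exact Eventually.of_forall fun y => by fun_prop

theorem exists_symbol_re_le : ∃ C : ℝ, 0 ≤ C ∧ ∀ ξ, 1 + (χ.symbol ξ).re ≤ C * (1 + ‖ξ‖ ^ 2) := by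
  set S := ∑ j, ∑ k, |χ.σ j k| with hS
  set M := ∫ y, min (‖y‖ ^ 2) 1 ∂χ.F with hM
  have hS0 : 0 ≤ S := Finset.sum_nonneg fun j _ => Finset.sum_nonneg fun k _ => abs_nonneg _
  have hM0 : 0 ≤ M := integral_nonneg fun y => by positivity
  refine ⟨1 + S + 2 * M, by positivity, fun ξ => ?_⟩
  rw [symbol_re]
  have h1 : ∑ j, ∑ k, ξ j * χ.σ j k * ξ k ≤ S * ‖ξ‖ ^ 2 := by
    rw [hS, Finset.sum_mul]
    refine Finset.sum_le_sum fun j _ => ?_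
    rw [Finset.sum_mul]
    refine Finset.sum_le_sum fun k _ => ?_
    refine (le_abs_self _).trans ?_
    rw [abs_mul, abs_mul]
    have hj : |ξ j| ≤ ‖ξ‖ := by simpa using PiLp.norm_apply_le ξ j
    have hk : |ξ k| ≤ ‖ξ‖ := by simpa using PiLp.norm_apply_le ξ k
    calc |ξ j| * |χ.σ j k| * |ξ k| ≤ ‖ξ‖ * |χ.σ j k| * ‖ξ‖ := by gcongr
      _ = |χ.σ j k| * ‖ξ‖ ^ 2 := by ring
  have h2 : ∫ y, (1 - Real.cos ⟪ξ, y⟫_ℝ) ∂χ.F ≤ (2 + ‖ξ‖ ^ 2) * M := by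
    rw [hM, ← integral_const_mul]
    exact integral_mono_of_nonneg (Eventually.of_forall fun y => one_sub_cos_nonneg _)
      (χ.integrable_min.const_mul _) (Eventually.of_forall fun y => one_sub_cos_inner_le ξ y)
  nlinarith [sq_nonneg ‖ξ‖, mul_nonneg hS0 (sq_nonneg ‖ξ‖), mul_nonneg hM0 (sq_nonneg ‖ξ‖)]

end LevyCharacteristics

/-- The space `C_0^∞(ℝ^d, ℝ)`. -/
abbrev TestFn (d : ℕ) : Type := 𝓓((⊤ : TopologicalSpace.Opens (EuclideanSpace ℝ (Fin d))), ℝ)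

/-- The Fourier transform `û(ξ) = ∫ e^{i⟨ξ, x⟩} u(x) dx`. -/
def hatFourier {d : ℕ} (u : EuclideanSpace ℝ (Fin d) → ℝ) (ξ : EuclideanSpace ℝ (Fin d)) : ℂ :=
  ∫ x, Complex.exp (Complex.I * (⟪ξ, x⟫_ℝ : ℝ)) * (u x : ℂ)

namespace TestFn

variable {d : ℕ}

/-- A real test function as a complex Schwartz function. -/
def toSchwartz (u : TestFn d) : SchwartzMap (EuclideanSpace ℝ (Fin d)) ℂ :=
  HasCompactSupport.toSchwartzMap (f := fun x => ((u x : ℝ) : ℂ))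
    (u.hasCompactSupport.comp_left (g := fun r : ℝ => (r : ℂ)) Complex.ofReal_zero)
    (Complex.ofRealCLM.contDiff.comp u.contDiff)

theorem toSchwartz_apply (u : TestFn d) (x : EuclideanSpace ℝ (Fin d)) :
    u.toSchwartz x = ((u x : ℝ) : ℂ) := rfl

theorem hatFourier_eq (u : TestFn d) (ξ : EuclideanSpace ℝ (Fin d)) :
    hatFourier u ξ = 𝓕 u.toSchwartz (-(2 * Real.pi)⁻¹ • ξ) := by
  rw [SchwartzMap.fourier_coe, Real.fourier_eq', hatFourier]
  refine integral_congr_ae (Eventually.of_forall fun x => ?_)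
  simp only [toSchwartz_apply, inner_smul_right, smul_eq_mul]
  congr 2
  rw [real_inner_comm]
  push_cast
  have : (Real.pi : ℂ) ≠ 0 := by exact_mod_cast Real.pi_ne_zero
  field_simp

/-- The Fourier transform of a test function as a Schwartz function. -/
theorem exists_hat (u : TestFn d) :
    ∃ Φ : SchwartzMap (EuclideanSpace ℝ (Fin d)) ℂ, ∀ ξ, Φ ξ = hatFourier u ξ := by
  have hc : (-(2 * Real.pi)⁻¹ : ℝ) ≠ 0 := by
    have := Real.pi_pos
    simp [this.ne']
  refine ⟨SchwartzMap.compCLMOfContinuousLinearEquiv ℂ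
    (ContinuousLinearEquiv.smulLeft (Units.mk0 (-(2 * Real.pi)⁻¹ : ℝ) hc)) (𝓕 u.toSchwartz), ?_⟩
  intro ξ
  rw [hatFourier_eq]
  rfl

theorem hatFourier_add (u v : TestFn d) (ξ : EuclideanSpace ℝ (Fin d)) :
    hatFourier (u + v : TestFn d) ξ = hatFourier u ξ + hatFourier v ξ := by
  have : (u + v).toSchwartz = u.toSchwartz + v.toSchwartz := by
    ext x; simp [toSchwartz_apply]
  rw [hatFourier_eq, hatFourier_eq, hatFourier_eq, this, FourierTransform.fourier_add]
  rfl

theorem hatFourier_smul (r : ℝ) (u : TestFn d) (ξ : EuclideanSpace ℝ (Fin d)) :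
    hatFourier (r • u : TestFn d) ξ = r * hatFourier u ξ := by
  simp [hatFourier, ← integral_const_mul, mul_left_comm]

end TestFn

namespace LevyCharacteristics

variable {d : ℕ} (χ : LevyCharacteristics d)

theorem integrable_energy (u v : TestFn d) :
    Integrable (fun ξ => (1 + (χ.symbol ξ).re : ℝ) *
      (hatFourier u ξ * starRingEnd ℂ (hatFourier v ξ))) := by
  obtain ⟨Φ, hΦ⟩ := u.exists_hat
  obtain ⟨Ψ, hΨ⟩ := v.exists_hat
  simp only [← hΦ, ← hΨ]
  obtain ⟨C, hC0, hC⟩ := χ.exists_symbol_re_le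
  obtain ⟨B, hB⟩ : ∃ B, ∀ ξ, ‖Ψ ξ‖ ≤ B := by
    obtain ⟨B, -, hB⟩ := Ψ.decay 0 0
    exact ⟨B, fun ξ => by simpa using hB ξ⟩
  have hB0 : 0 ≤ B := (norm_nonneg _).trans (hB 0)
  have hI : Integrable fun ξ => C * B * (‖Φ ξ‖ + ‖ξ‖ ^ 2 * ‖Φ ξ‖) :=
    (Φ.integrable.norm.add (Φ.integrable_pow_mul volume 2)).const_mul _
  refine hI.mono' ?_ (Eventually.of_forall fun ξ => ?_)
  · refine Continuous.aestronglyMeasurable ?_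
    have := χ.continuous_symbol_re
    have h1 := Φ.continuous
    have h2 := Complex.continuous_conj.comp Ψ.continuous
    exact (Complex.continuous_ofReal.comp (continuous_const.add this)).mul (h1.mul h2)
  · have h0 := χ.symbol_re_nonneg ξ
    rw [norm_mul, norm_mul, RCLike.norm_conj, Complex.norm_real,
      Real.norm_of_nonneg (by linarith)]
    calc (1 + (χ.symbol ξ).re) * (‖Φ ξ‖ * ‖Ψ ξ‖)
        ≤ (C * (1 + ‖ξ‖ ^ 2)) * (‖Φ ξ‖ * B) := by
          gcongr
          · exact hC ξ
          · exact hB ξ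
      _ = C * B * (‖Φ ξ‖ + ‖ξ‖ ^ 2 * ‖Φ ξ‖) := by ring

/-- The space `C_0^∞(ℝ^d, ℝ)`, to be equipped with the norm `‖·‖_{Re A}`. -/
def PreEnergy (_χ : LevyCharacteristics d) : Type := TestFn d

instance : AddCommGroup χ.PreEnergy := inferInstanceAs (AddCommGroup (TestFn d))

instance : Module ℝ χ.PreEnergy := inferInstanceAs (Module ℝ (TestFn d))

/-- The identity map. -/
def toTest : χ.PreEnergy ≃ₗ[ℝ] TestFn d := LinearEquiv.refl ℝ (TestFn d)

/-- The real inner product `Re ∫ (1 + Re A(ξ)) û(ξ) conj(v̂(ξ)) dξ`, whose associated norm is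
`‖u‖² = ∫ (1 + Re A(ξ)) |û(ξ)|² dξ`. -/
@[reducible] def energyCore : PreInnerProductSpace.Core ℝ χ.PreEnergy where
  inner u v := (∫ ξ, (1 + (χ.symbol ξ).re : ℝ) *
    (hatFourier (χ.toTest u) ξ * starRingEnd ℂ (hatFourier (χ.toTest v) ξ))).re
  conj_inner_symm u v := by
    simp only [conj_trivial]
    rw [← Complex.conj_re, ← integral_conj]
    congr 2
    funext ξ
    simp only [map_mul, Complex.conj_ofReal, Complex.conj_conj]
    ring
  re_inner_nonneg u := by
    have : ∀ ξ, ((1 + (χ.symbol ξ).re : ℝ) : ℂ) *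
        (hatFourier (χ.toTest u) ξ * starRingEnd ℂ (hatFourier (χ.toTest u) ξ))
        = (((1 + (χ.symbol ξ).re) * ‖hatFourier (χ.toTest u) ξ‖ ^ 2 : ℝ) : ℂ) := by
      intro ξ
      rw [Complex.mul_conj, Complex.normSq_eq_norm_sq]
      push_cast
      ring
    simp only [this, integral_complex_ofReal]
    exact integral_nonneg fun ξ =>
      mul_nonneg (by linarith [χ.symbol_re_nonneg ξ]) (by positivity)
  add_left u v w := by
    rw [← Complex.add_re, ← integral_add (χ.integrable_energy (χ.toTest u) (χ.toTest w))
      (χ.integrable_energy (χ.toTest v) (χ.toTest w))]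
    congr 2
    funext ξ
    rw [map_add, TestFn.hatFourier_add]
    ring
  smul_left u v r := by
    rw [conj_trivial, ← Complex.re_ofReal_mul, ← integral_const_mul]
    congr 2
    funext ξ
    rw [map_smul, TestFn.hatFourier_smul]
    ring

instance : SeminormedAddCommGroup χ.PreEnergy :=
  @InnerProductSpace.Core.toSeminormedAddCommGroup ℝ χ.PreEnergy _ _ _ χ.energyCore

instance : InnerProductSpace ℝ χ.PreEnergy :=
  InnerProductSpace.ofCore χ.energyCore

theorem norm_sq_preEnergy (u : χ.PreEnergy) :
    ‖u‖ ^ 2 = ∫ ξ, (1 + (χ.symbol ξ).re) * ‖hatFourier (χ.toTest u) ξ‖ ^ 2 := by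
  rw [← real_inner_self_eq_norm_sq]
  change (∫ ξ, (1 + (χ.symbol ξ).re : ℝ) *
    (hatFourier (χ.toTest u) ξ * starRingEnd ℂ (hatFourier (χ.toTest u) ξ))).re = _
  rw [← Complex.ofReal_re (∫ ξ, (1 + (χ.symbol ξ).re) * ‖hatFourier (χ.toTest u) ξ‖ ^ 2),
    ← integral_complex_ofReal]
  congr 2
  funext ξ
  rw [Complex.mul_conj, Complex.normSq_eq_norm_sq]
  push_cast
  ring

/-- The space `H^{Re A}`: the completion of `C_0^∞(ℝ^d, ℝ)` with respect to `‖·‖_{Re A}`. -/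
abbrev EnergySpace : Type := UniformSpace.Completion χ.PreEnergy

/-- The canonical dense map `C_0^∞(ℝ^d, ℝ) → H^{Re A}`. -/
def toEnergy (u : TestFn d) : χ.EnergySpace := ((χ.toTest.symm u : χ.PreEnergy) : UniformSpace.Completion χ.PreEnergy)

/-- The map sending a test function to its class in `L²(ℝ^d)`. -/
def preToL2 : χ.PreEnergy →ₗ[ℝ] Lp ℝ 2 (volume : Measure (EuclideanSpace ℝ (Fin d))) where
  toFun u := MemLp.toLp (χ.toTest u)
    ((χ.toTest u).continuous.memLp_of_hasCompactSupport (χ.toTest u).hasCompactSupport)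
  map_add' _ _ := rfl
  map_smul' _ _ := rfl

theorem norm_preToL2_le (u : χ.PreEnergy) : ‖χ.preToL2 u‖ ≤ 1 * ‖u‖ := by
  rw [one_mul]
  refine le_of_sq_le_sq ?_ (norm_nonneg _)
  have hL2 : ‖χ.preToL2 u‖ ^ 2 = ∫ x, ‖χ.toTest u x‖ ^ 2 := by
    rw [← real_inner_self_eq_norm_sq, L2.inner_def]
    refine integral_congr_ae ?_
    filter_upwards [MemLp.coeFn_toLp ((χ.toTest u).continuous.memLp_of_hasCompactSupport
      (p := 2) (μ := volume) (χ.toTest u).hasCompactSupport)] with x hx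
    rw [show (χ.preToL2 u : EuclideanSpace ℝ (Fin d) → ℝ) x = χ.toTest u x from hx,
      real_inner_self_eq_norm_sq]
  have hP : ∫ x, ‖χ.toTest u x‖ ^ 2 = ∫ ξ, ‖𝓕 (χ.toTest u).toSchwartz ξ‖ ^ 2 := by
    rw [SchwartzMap.integral_norm_sq_fourier]
    simp [TestFn.toSchwartz_apply]
  have hS : ∫ ξ, ‖hatFourier (χ.toTest u) ξ‖ ^ 2
      = (2 * Real.pi) ^ d * ∫ ξ, ‖𝓕 (χ.toTest u).toSchwartz ξ‖ ^ 2 := by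
    simp only [TestFn.hatFourier_eq]
    rw [Measure.integral_comp_smul volume
      (fun ξ => ‖𝓕 (χ.toTest u).toSchwartz ξ‖ ^ 2) (-(2 * Real.pi)⁻¹)]
    rw [finrank_euclideanSpace_fin, smul_eq_mul, abs_inv, abs_pow, abs_neg,
      abs_of_pos (by positivity : (0 : ℝ) < (2 * Real.pi)⁻¹), inv_pow, inv_inv]
  have h0 : 0 ≤ ∫ ξ, ‖𝓕 (χ.toTest u).toSchwartz ξ‖ ^ 2 :=
    integral_nonneg fun _ => by positivity
  have h1 : (1 : ℝ) ≤ (2 * Real.pi) ^ d := one_le_pow₀ (by linarith [Real.pi_gt_three])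
  rw [hL2, hP]
  refine (le_mul_of_one_le_left h0 h1).trans ?_
  rw [← hS, norm_sq_preEnergy]
  refine integral_mono_of_nonneg (Eventually.of_forall fun _ => by positivity) ?_
    (Eventually.of_forall fun ξ => ?_)
  · refine (χ.integrable_energy (χ.toTest u) (χ.toTest u)).norm.congr
      (Eventually.of_forall fun ξ => ?_)
    simp only [norm_mul, RCLike.norm_conj, Complex.norm_real]
    rw [Real.norm_of_nonneg (by linarith [χ.symbol_re_nonneg ξ])]
    ring
  · have := mul_nonneg (χ.symbol_re_nonneg ξ) (sq_nonneg ‖hatFourier (χ.toTest u) ξ‖)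
    linarith

/-- The embedding `H^{Re A} ↪ L²(ℝ^d)`: the continuous extension of the inclusion of the test
functions. -/
def toL2 : χ.EnergySpace →L[ℝ] Lp ℝ 2 (volume : Measure (EuclideanSpace ℝ (Fin d))) :=
  (χ.preToL2.mkContinuous 1 χ.norm_preToL2_le).extend
    (UniformSpace.Completion.toComplL (𝕜 := ℝ) (E := χ.PreEnergy))

theorem toL2_toEnergy (u : TestFn d) :
    χ.toL2 (χ.toEnergy u) = MemLp.toLp u
      (u.continuous.memLp_of_hasCompactSupport u.hasCompactSupport) :=
  ContinuousLinearMap.extend_eq _ UniformSpace.Completion.denseRange_coe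
    (UniformSpace.Completion.isUniformInducing_coe _) (χ.toTest.symm u)

/-- `a` is the bilinear form of the operator `𝒜` on `H^{Re A}`: a continuous bilinear form with
`a(u, v) = ∫ (𝒜 u)(x) v(x) dx` for all `u, v ∈ C_0^∞(ℝ^d, ℝ)`. -/
def IsBilinearFormOf (a : χ.EnergySpace →L[ℝ] χ.EnergySpace →L[ℝ] ℝ) : Prop :=
  ∀ u v : TestFn d, a (χ.toEnergy u) (χ.toEnergy v) = ∫ x, χ.operator u x * v x

end LevyCharacteristics

/-! ## Gårding inequality, the space `W^1(0, T; V, H)` and parabolic equations -/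

section Parabolic

variable {V H : Type*} [NormedAddCommGroup V] [InnerProductSpace ℝ V]
  [NormedAddCommGroup H] [InnerProductSpace ℝ H]

/-- The Gårding inequality for the bilinear form `a` with respect to `j : V ↪ H`. -/
def GardingInequality (j : V →L[ℝ] H) (a : V →L[ℝ] V →L[ℝ] ℝ) : Prop :=
  ∃ c₂ > 0, ∃ c₃ ≥ 0, ∀ u, a u u ≥ c₂ * ‖u‖ ^ 2 - c₃ * ‖j u‖ ^ 2

/-- The embedding `V ↪ H ≅ H* ↪ V*`, `u ↦ (v ↦ ⟨j u, j v⟩_H)`, of the Gelfand triplet. -/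
def gelfandMap (j : V →L[ℝ] H) (u : V) : StrongDual ℝ V := (innerSL ℝ (j u)).comp j

/-- `w ∈ L²(0, T; V*)` is the distributional time derivative of `u ∈ L²(0, T; V)`. -/
def HasTimeDeriv (j : V →L[ℝ] H) (T : ℝ)
    (u : Lp V 2 (volume.restrict (Set.Ioo 0 T)))
    (w : Lp (StrongDual ℝ V) 2 (volume.restrict (Set.Ioo 0 T))) : Prop :=
  ∀ φ : 𝓓((⟨Set.Ioo 0 T, isOpen_Ioo⟩ : TopologicalSpace.Opens ℝ), ℝ),
    ∫ t in Set.Ioo 0 T, deriv φ t • gelfandMap j (u t) = -∫ t in Set.Ioo 0 T, φ t • w t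

/-- The space `W^1(0, T; V, H)`: all `u ∈ L²(0, T; V)` that have a distributional time derivative
in `L²(0, T; V*)`. -/
def SpaceW1 (j : V →L[ℝ] H) (T : ℝ) : Set (Lp V 2 (volume.restrict (Set.Ioo 0 T))) :=
  {u | ∃ w, HasTimeDeriv j T u w}

/-- `u(0) = g`: the function `u` has a representative in `C([0, T]; H)` with value `g` at `0`. -/
def HasInitialValue (j : V →L[ℝ] H) (T : ℝ)
    (u : Lp V 2 (volume.restrict (Set.Ioo 0 T))) (g : H) : Prop :=
  ∃ U : ℝ → H, ContinuousOn U (Set.Icc 0 T) ∧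
    (∀ᵐ t ∂(volume.restrict (Set.Ioo 0 T)), j (u t) = U t) ∧ U 0 = g

/-- `u ∈ W^1(0, T; V, H)` solves `u' + 𝒜 u = f`, `u(0) = g`, where `𝒜 : V → V*` is the operator
`(𝒜 u)(v) = a(u, v)` and the equation is an identity in `V*` for almost every `t ∈ (0, T)`. -/
def IsParabolicSolution (j : V →L[ℝ] H) (a : V →L[ℝ] V →L[ℝ] ℝ) (T : ℝ)
    (f : Lp (StrongDual ℝ V) 2 (volume.restrict (Set.Ioo 0 T))) (g : H)
    (u : Lp V 2 (volume.restrict (Set.Ioo 0 T))) : Prop :=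
  u ∈ SpaceW1 j T ∧
  (∃ w, HasTimeDeriv j T u w ∧
    ∀ᵐ t ∂(volume.restrict (Set.Ioo 0 T)), w t + a (u t) = f t) ∧
  HasInitialValue j T u g

end Parabolic

end

/-! For û(ξ) = ∫ e^{i⟨ξ,x⟩} u(x) dx, the derivative ∂_j becomes multiplication by -iξ_j and
translation by y becomes multiplication by e^{-i⟨ξ,y⟩}. So `operator` is the Fourier multiplier with
symbol A (`operator_eq_inverseHat`), and Parseval gives a(u,v) = Re (2π)^{-d} ∫ A û conj(v̂).
Continuity follows from |A| ≤ (1+c)(1+Re A) and the weighted Cauchy-Schwarz inequality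
(`norm_symbolForm_le`). On the diagonal only Re A = (1 + Re A) - 1 contributes, so the Gårding
inequality is an identity with constants (2π)^{-d} and 1 (`symbolForm_self_re`). It extends to the
completion by density.

The parabolic equation is solved for any Hilbert space V, any j : V → H with dense range and any
form with a Gårding inequality. The Riesz isomorphism turns it into (J u)' + B u = f in V, where J =
j*j and B represents a.

Uniqueness works with x(t) = ∫_0^t u instead of u. For a homogeneous solution, x is continuous into
V and (J x)' = -B x, so the energy ‖j x‖² can be differentiated directly. Gronwall gives j x = 0,
and coercivity then gives x = 0 (`ae_eq_zero_of_eq_neg_integral`).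

Existence is by approximation. For x = v + ∫ y with y continuous, `exists_energy_bound` controls x
in L²(0,T;V) and j x uniformly on [0,T] by ‖j v‖ and the L² norm of J x' + B x. These right-hand
sides are dense (`denseRange_evolutionMap`), because anything orthogonal to them solves a backward
homogeneous equation for B* and so vanishes by the uniqueness argument. Hence suitable regular
functions are Cauchy in both norms, and their limit is the solution. -/

noncomputable section

/-! ### Primitives, test functions and weak derivatives on (0, T). -/

section TimeIntegrals

theorem intervalIntegrable_of_integrableOn_Ioo {E : Type*} [NormedAddCommGroup E] {T : ℝ} {w : ℝ → E}
    (hw : IntegrableOn w (Set.Ioo 0 T)) {a b : ℝ} (ha : a ∈ Set.Icc 0 T) (hb : b ∈ Set.Icc 0 T) :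
    IntervalIntegrable w volume a b := by
  have h1 : IntervalIntegrable w volume 0 T := by
    rw [intervalIntegrable_iff_integrableOn_Ioo_of_le (ha.1.trans ha.2)]
    exact hw
  refine h1.mono_set ?_
  rw [Set.uIcc_of_le (ha.1.trans ha.2)]
  exact Set.uIcc_subset_Icc ha hb

variable {E : Type*} [NormedAddCommGroup E] [NormedSpace ℝ E]

theorem setIntegral_Ioo_eq_intervalIntegral {T : ℝ} (hT : 0 ≤ T) (w : ℝ → E) :
    ∫ t in Set.Ioo 0 T, w t = ∫ t in 0..T, w t := by
  rw [intervalIntegral.integral_of_le hT, integral_Ioc_eq_integral_Ioo]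

/-- Fubini's theorem on the triangle `0 < s < t < T`. -/
theorem integral_primitive_smul [CompleteSpace E] {T : ℝ} {φ : ℝ → ℝ} (hφ : Continuous φ) {w : ℝ → E}
    (hw : IntegrableOn w (Set.Ioo 0 T)) :
    ∫ t in Set.Ioo 0 T, (∫ s in 0..t, φ s) • w t
      = ∫ s in Set.Ioo 0 T, φ s • ∫ t in s..T, w t := by
  set μ := (volume : Measure ℝ).restrict (Set.Ioo 0 T) with hμ
  have hφi : Integrable φ μ :=
    (hφ.continuousOn.integrableOn_Icc (a := 0) (b := T)).mono_set Set.Ioo_subset_Icc_self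
  have hint : Integrable
      (Function.uncurry fun t s => (if s < t then φ s else 0) • w t) (μ.prod μ) := by
    have h1 : Integrable (fun p : ℝ × ℝ => φ p.2 • w p.1) (μ.prod μ) := by
      have := (hφi.smul_prod hw).swap
      exact this
    have h2 : MeasurableSet {p : ℝ × ℝ | p.2 < p.1} := measurableSet_lt measurable_snd measurable_fst
    refine (h1.indicator h2).congr (Eventually.of_forall fun p => ?_)
    by_cases h : p.2 < p.1 <;> simp [Function.uncurry, Set.indicator, h]
  have hl : ∀ t ∈ Set.Ioo 0 T, (∫ s in 0..t, φ s) • w t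
      = ∫ s, (if s < t then φ s else 0) • w t ∂μ := by
    intro t ht
    rw [integral_smul_const]
    congr 1
    have : (fun s => if s < t then φ s else 0) = (Set.Iio t).indicator φ := by
      funext s; simp [Set.indicator]
    rw [this, integral_indicator measurableSet_Iio, hμ, Measure.restrict_restrict measurableSet_Iio,
      ← setIntegral_Ioo_eq_intervalIntegral ht.1.le]
    congr 2
    ext s
    simp only [Set.mem_Ioo, Set.mem_inter_iff, Set.mem_Iio]
    exact ⟨fun h => ⟨h.2, h.1, h.2.trans ht.2⟩, fun h => ⟨h.2.1, h.1⟩⟩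
  have hr : ∀ s ∈ Set.Ioo 0 T, φ s • ∫ t in s..T, w t
      = ∫ t, (if s < t then φ s else 0) • w t ∂μ := by
    intro s hs
    have : (fun t => (if s < t then φ s else 0) • w t)
        = (Set.Ioi s).indicator (fun t => φ s • w t) := by
      funext t; by_cases h : s < t <;> simp [Set.indicator, h]
    rw [this, integral_indicator measurableSet_Ioi, hμ, Measure.restrict_restrict measurableSet_Ioi,
      integral_smul, intervalIntegral.integral_of_le hs.2.le, integral_Ioc_eq_integral_Ioo]
    congr 3
    ext t
    simp only [Set.mem_Ioo, Set.mem_inter_iff, Set.mem_Ioi]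
    exact ⟨fun h => ⟨h.1, hs.1.trans h.1, h.2⟩, fun h => ⟨h.1, h.2.2⟩⟩
  rw [setIntegral_congr_fun measurableSet_Ioo hl, setIntegral_congr_fun measurableSet_Ioo hr]
  exact integral_integral_swap hint

theorem eq_zero_of_tsupport_subset_Ioo {T : ℝ} {ψ : ℝ → ℝ} (hs : tsupport ψ ⊆ Set.Ioo 0 T) {t : ℝ}
    (ht : t ∉ Set.Ioo 0 T) : ψ t = 0 :=
  image_eq_zero_of_notMem_tsupport fun h => ht (hs h)

theorem setIntegral_Ioo_smul_eq {T : ℝ} {ψ : ℝ → ℝ} (hs : tsupport ψ ⊆ Set.Ioo 0 T) (w : ℝ → E) :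
    ∫ t in Set.Ioo 0 T, ψ t • w t = ∫ t, ψ t • w t :=
  setIntegral_eq_integral_of_forall_compl_eq_zero fun t ht => by
    rw [eq_zero_of_tsupport_subset_Ioo hs ht, zero_smul]

/-- Integration by parts for w that is merely integrable: insert ψ(t) = ∫_0^t ψ' and exchange the
integrals over the triangle. -/
theorem integral_smul_eq_integral_deriv_smul [CompleteSpace E] {T : ℝ} {ψ : ℝ → ℝ} (hψ : ContDiff ℝ 1 ψ)
    (hs : tsupport ψ ⊆ Set.Ioo 0 T) {w : ℝ → E} (hw : IntegrableOn w (Set.Ioo 0 T)) :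
    ∫ t in Set.Ioo 0 T, ψ t • w t = ∫ s in Set.Ioo 0 T, deriv ψ s • ∫ t in s..T, w t := by
  have hc : Continuous (deriv ψ) := hψ.continuous_deriv le_rfl
  rw [← integral_primitive_smul hc hw]
  refine setIntegral_congr_fun measurableSet_Ioo fun t _ => ?_
  rw [intervalIntegral.integral_deriv_eq_sub
    (fun s _ => (hψ.differentiable one_ne_zero) s) (hc.intervalIntegrable _ _),
    eq_zero_of_tsupport_subset_Ioo hs (t := 0) (by simp), sub_zero]

theorem ae_eq_zero_of_integral_test_smul [CompleteSpace E] {T : ℝ} {w : ℝ → E}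
    (hw : IntegrableOn w (Set.Ioo 0 T))
    (h : ∀ ψ : ℝ → ℝ, ContDiff ℝ (⊤ : ℕ∞) ψ → HasCompactSupport ψ → tsupport ψ ⊆ Set.Ioo 0 T →
      ∫ t in Set.Ioo 0 T, ψ t • w t = 0) :
    ∀ᵐ t ∂(volume.restrict (Set.Ioo 0 T)), w t = 0 := by
  rw [ae_restrict_iff' measurableSet_Ioo]
  refine isOpen_Ioo.ae_eq_zero_of_integral_contDiff_smul_eq_zero hw.locallyIntegrableOn ?_
  intro g h1 h2 h3
  rw [← setIntegral_Ioo_smul_eq h3]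
  exact h g h1 h2 h3

theorem ae_eq_zero_of_intervalIntegral_eq_zero [CompleteSpace E] {T : ℝ} {w : ℝ → E}
    (hw : IntegrableOn w (Set.Ioo 0 T)) (h : ∀ t ∈ Set.Ioo 0 T, ∫ s in t..T, w s = 0) :
    ∀ᵐ t ∂(volume.restrict (Set.Ioo 0 T)), w t = 0 := by
  refine ae_eq_zero_of_integral_test_smul hw fun ψ h1 _ h3 => ?_
  rw [integral_smul_eq_integral_deriv_smul (h1.of_le (by exact_mod_cast le_top)) h3 hw]
  refine integral_eq_zero_of_ae ?_
  filter_upwards [ae_restrict_mem measurableSet_Ioo] with t ht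
  simp [h t ht]

theorem continuousOn_tail {T : ℝ} (hT : 0 ≤ T) {w : ℝ → E} (hw : IntegrableOn w (Set.Ioo 0 T)) :
    ContinuousOn (fun t => ∫ s in t..T, w s) (Set.Icc 0 T) := by
  have h1 : IntegrableOn w (Set.uIcc 0 T) := by
    rw [Set.uIcc_of_le hT, integrableOn_Icc_iff_integrableOn_Ioo]
    exact hw
  have := intervalIntegral.continuousOn_primitive_interval_left h1
  rwa [Set.uIcc_of_le hT] at this

theorem integrableOn_Ioo_smul {T : ℝ} {φ : ℝ → ℝ} (hφ : Continuous φ) {w : ℝ → E}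
    (hw : IntegrableOn w (Set.Ioo 0 T)) : IntegrableOn (fun t => φ t • w t) (Set.Ioo 0 T) := by
  obtain ⟨C, hC⟩ := isCompact_Icc.exists_bound_of_continuousOn (hφ.continuousOn (s := Set.Icc 0 T))
  refine Integrable.bdd_smul hw C hφ.aestronglyMeasurable ?_
  filter_upwards [ae_restrict_mem measurableSet_Ioo] with t ht
  exact hC t (Set.Ioo_subset_Icc_self ht)

/-- The lemma of du Bois-Reymond. -/
theorem exists_ae_eq_sub_integral [CompleteSpace E] {T : ℝ} (hT : 0 < T) {w h : ℝ → E}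
    (hw : IntegrableOn w (Set.Ioo 0 T)) (hh : IntegrableOn h (Set.Ioo 0 T))
    (H : ∀ ψ : ℝ → ℝ, ContDiff ℝ (⊤ : ℕ∞) ψ → HasCompactSupport ψ → tsupport ψ ⊆ Set.Ioo 0 T →
      ∫ t in Set.Ioo 0 T, deriv ψ t • h t = -∫ t in Set.Ioo 0 T, ψ t • w t) :
    ∃ c : E, ∀ᵐ t ∂(volume.restrict (Set.Ioo 0 T)), h t = c - ∫ s in t..T, w s := by
  -- The tail integral has derivative -w, so k has distributional derivative zero and must be shown
  -- to be constant.
  set k : ℝ → E := fun t => h t + ∫ s in t..T, w s with hk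
  have hki : IntegrableOn k (Set.Ioo 0 T) :=
    hh.add ((continuousOn_tail hT.le hw).integrableOn_Icc.mono_set Set.Ioo_subset_Icc_self)
  have hti : IntegrableOn (fun t => ∫ s in t..T, w s) (Set.Ioo 0 T) :=
    (continuousOn_tail hT.le hw).integrableOn_Icc.mono_set Set.Ioo_subset_Icc_self
  have H' : ∀ ψ : ℝ → ℝ, ContDiff ℝ (⊤ : ℕ∞) ψ → HasCompactSupport ψ →
      tsupport ψ ⊆ Set.Ioo 0 T → ∫ t in Set.Ioo 0 T, deriv ψ t • k t = 0 := by
    intro ψ h1 h2 h3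
    have hc : Continuous (deriv ψ) := h1.continuous_deriv (by exact_mod_cast le_top)
    simp only [hk, smul_add]
    rw [integral_add (integrableOn_Ioo_smul hc hh) (integrableOn_Ioo_smul hc hti), H ψ h1 h2 h3,
      integral_smul_eq_integral_deriv_smul (h1.of_le (by exact_mod_cast le_top)) h3 hw]
    simp
  -- A bump of mass one, centred at T/2 with outer radius T/4; the constant will be the η-average of
  -- k.
  obtain ⟨η, hη0, hη1, hη2, hη3⟩ : ∃ η : ℝ → ℝ, ContDiff ℝ (⊤ : ℕ∞) η ∧ HasCompactSupport η ∧
      tsupport η ⊆ Set.Ioo 0 T ∧ ∫ t, η t = 1 := by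
    let b : ContDiffBump (T / 2) := ⟨T / 8, T / 4, by positivity, by linarith⟩
    refine ⟨b.normed volume, b.contDiff_normed, b.hasCompactSupport_normed, ?_, b.integral_normed⟩
    rw [b.tsupport_normed_eq, Real.closedBall_eq_Icc]
    intro t ht
    have h1 := ht.1
    have h2 := ht.2
    simp only [b] at h1 h2
    constructor <;> linarith
  refine ⟨∫ t in Set.Ioo 0 T, η t • k t, ?_⟩
  set c := ∫ t in Set.Ioo 0 T, η t • k t with hc
  suffices hs : ∀ᵐ t ∂(volume.restrict (Set.Ioo 0 T)), k t - c = 0 by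
    filter_upwards [hs] with t ht
    rw [← sub_eq_zero.1 ht]
    simp [hk]
  have hfin : IsFiniteMeasure (volume.restrict (Set.Ioo 0 T)) := by infer_instance
  refine ae_eq_zero_of_integral_test_smul (hki.sub (integrable_const c)) fun φ h1 h2 h3 => ?_
  set m := ∫ t, φ t with hm
  -- Since φ - mη has mean zero, its primitive is again supported in a compact subset of (0, T).
  -- Testing k with it yields ∫ φ k = m ∫ η k.
  set ψ : ℝ → ℝ := fun t => ∫ s in 0..t, (φ s - m * η s) with hψ
  have hcont : Continuous fun s => φ s - m * η s :=
    h1.continuous.sub (continuous_const.mul hη0.continuous)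
  have hder : ∀ t, HasDerivAt ψ (φ t - m * η t) t := fun t =>
    intervalIntegral.integral_hasDerivAt_right (hcont.intervalIntegrable _ _)
      (hcont.stronglyMeasurableAtFilter _ _) hcont.continuousAt
  have hderiv : deriv ψ = fun t => φ t - m * η t := funext fun t => (hder t).deriv
  have hψs : ContDiff ℝ (⊤ : ℕ∞) ψ := by
    rw [contDiff_infty_iff_deriv]
    refine ⟨fun t => (hder t).differentiableAt, ?_⟩
    rw [hderiv]
    exact h1.sub (contDiff_const.mul hη0)
  have hK : IsCompact (tsupport φ ∪ tsupport η) := h2.isCompact.union hη1.isCompact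
  have hKs : tsupport φ ∪ tsupport η ⊆ Set.Ioo 0 T := Set.union_subset h3 hη2
  have hg0 : ∀ t ∉ tsupport φ ∪ tsupport η, φ t - m * η t = 0 := by
    intro t ht
    rw [Set.mem_union, not_or] at ht
    rw [image_eq_zero_of_notMem_tsupport ht.1, image_eq_zero_of_notMem_tsupport ht.2]
    simp
  have htot : ∫ s, (φ s - m * η s) = 0 := by
    rw [integral_sub (h1.continuous.integrable_of_hasCompactSupport h2)
      ((hη0.continuous.integrable_of_hasCompactSupport hη1).const_mul _), integral_const_mul, hη3]
    simp [hm]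
  obtain ⟨α, β, hα, hβ, hαβ⟩ : ∃ α β : ℝ, 0 < α ∧ β < T ∧
      tsupport φ ∪ tsupport η ⊆ Set.Icc α β := by
    rcases (tsupport φ ∪ tsupport η).eq_empty_or_nonempty with he | hne
    -- Dummy endpoints: this case is vacuous, because η has integral one.
    · exact ⟨1, T - 1, one_pos, by linarith, by simp [he]⟩
    · exact ⟨sInf _, sSup _, (hKs (hK.sInf_mem hne)).1, (hKs (hK.sSup_mem hne)).2,
        fun t ht => ⟨csInf_le hK.bddBelow ht, le_csSup hK.bddAbove ht⟩⟩
  have hψsupp : ∀ t ∉ Set.Icc α β, ψ t = 0 := by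
    intro t ht
    rw [Set.mem_Icc, not_and_or, not_le, not_le] at ht
    rcases ht with ht | ht
    · simp only [hψ]
      refine intervalIntegral.integral_zero_ae (Eventually.of_forall fun s hs => hg0 s fun h => ?_)
      have h4 := (hαβ h).1
      rcases Set.mem_uIoc.1 hs with h5 | h5
      · linarith [h5.2]
      · linarith [h5.2]
    · have hsupp : Function.support (fun s => φ s - m * η s) ⊆ Set.Ioc (min 0 t) (max 0 t) := by
        intro s hs
        have h4 : s ∈ tsupport φ ∪ tsupport η := by
          by_contra h5
          exact hs (hg0 s h5)
        have h6 := hαβ h4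
        have h7 := hKs h4
        exact ⟨(min_le_left _ _).trans_lt h7.1, (h6.2.trans ht.le).trans (le_max_right _ _)⟩
      -- For t ≥ 0 the range of integration covers the whole support and the total integral is zero;
      -- for t < 0 it misses the support.
      by_cases h0 : 0 ≤ t
      · rw [min_eq_left h0, max_eq_right h0] at hsupp
        simp only [hψ]
        rw [intervalIntegral.integral_eq_integral_of_support_subset hsupp, htot]
      · simp only [hψ]
        refine intervalIntegral.integral_zero_ae
          (Eventually.of_forall fun s hs => hg0 s fun h => ?_)
        have h4 := (hKs h).1
        rcases Set.mem_uIoc.1 hs with h5 | h5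
        · linarith [h5.2]
        · linarith [h5.2]
  have hψt : tsupport ψ ⊆ Set.Icc α β :=
    closure_minimal (fun t ht => by by_contra h; exact ht (hψsupp t h)) isClosed_Icc
  have key := H' ψ hψs (HasCompactSupport.of_support_subset_isCompact isCompact_Icc
    (subset_closure.trans hψt)) (hψt.trans fun t ht => ⟨hα.trans_le ht.1, ht.2.trans_lt hβ⟩)
  simp only [hderiv, sub_smul, mul_smul] at key
  rw [integral_sub (integrableOn_Ioo_smul h1.continuous hki)
    (show Integrable (fun t => m • η t • k t) _ from
      (integrableOn_Ioo_smul hη0.continuous hki).smul m), integral_smul, ← hc, sub_eq_zero] at key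
  simp only [smul_sub]
  rw [integral_sub (integrableOn_Ioo_smul h1.continuous hki) (integrableOn_Ioo_smul h1.continuous (integrable_const c)),
    integral_smul_const, key]
  have : ∫ t in Set.Ioo 0 T, φ t = m := by
    have := setIntegral_Ioo_smul_eq h3 (fun _ => (1 : ℝ))
    simpa using this
  rw [this, sub_self]

end TimeIntegrals

/-! ### Energy methods for (J u)' + B u = f in a Hilbert space. -/

section Evolution

variable {V H : Type*} [NormedAddCommGroup V] [InnerProductSpace ℝ V]
  [NormedAddCommGroup H] [InnerProductSpace ℝ H] {j : V →L[ℝ] H} {J B : V →L[ℝ] V} {c₂ c₃ : ℝ}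

/-- Symmetry of J gives ‖j x(s)‖² - ‖j x(t)‖² = ⟨J x(s) - J x(t), x(s) + x(t)⟩. Hence continuity of
x together with differentiability of J x suffices; x itself need not be differentiable. -/
theorem hasDerivAt_norm_sq_of_hasDerivAt (hJ : ∀ x y, ⟪J x, y⟫_ℝ = ⟪j x, j y⟫_ℝ)
    {x : ℝ → V} {t : ℝ} {z : V} (hx : ContinuousAt x t) (hz : HasDerivAt (fun s => J (x s)) z t) :
    HasDerivAt (fun s => ‖j (x s)‖ ^ 2) (2 * ⟪z, x t⟫_ℝ) t := by
  have hsq : ∀ y, ‖j y‖ ^ 2 = ⟪J y, y⟫_ℝ := fun y => by rw [hJ, real_inner_self_eq_norm_sq]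
  rw [hasDerivAt_iff_tendsto_slope] at hz ⊢
  have h1 : Tendsto (fun s => ⟪slope (fun s => J (x s)) t s, x s + x t⟫_ℝ) (𝓝[≠] t)
      (𝓝 ⟪z, x t + x t⟫_ℝ) :=
    hz.inner ((hx.tendsto.mono_left nhdsWithin_le_nhds).add tendsto_const_nhds)
  have h2 : 2 * ⟪z, x t⟫_ℝ = ⟪z, x t + x t⟫_ℝ := by rw [inner_add_right]; ring
  rw [h2]
  refine h1.congr fun s => ?_
  simp only [slope_def_module, smul_eq_mul, real_inner_smul_left, hsq]
  rw [inner_sub_left, inner_add_right, inner_add_right, hJ (x s) (x t), hJ (x t) (x s),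
    real_inner_comm (j (x t)) (j (x s))]
  ring

theorem hasDerivAt_primitive [CompleteSpace V] {y : ℝ → V} (hy : Continuous y) (v : V) (t : ℝ) :
    HasDerivAt (fun t => v + ∫ s in 0..t, y s) (y t) t :=
  (intervalIntegral.integral_hasDerivAt_right (hy.intervalIntegrable _ _)
    (hy.stronglyMeasurableAtFilter _ _) hy.continuousAt).const_add v

/-- A function with values in `V` which is a weak solution of the homogeneous equation with zero
initial value vanishes. -/
theorem ae_eq_zero_of_eq_neg_integral [CompleteSpace V]
    (hJ : ∀ x y, ⟪J x, y⟫_ℝ = ⟪j x, j y⟫_ℝ) (hc₂ : 0 < c₂)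
    (hB : ∀ x, c₂ * ‖x‖ ^ 2 - c₃ * ‖j x‖ ^ 2 ≤ ⟪B x, x⟫_ℝ) {T : ℝ} (hT : 0 < T) {u : ℝ → V}
    (hu : IntegrableOn u (Set.Ioo 0 T))
    (h : ∀ᵐ t ∂(volume.restrict (Set.Ioo 0 T)), J (u t) = -B (∫ s in 0..t, u s)) :
    ∀ᵐ t ∂(volume.restrict (Set.Ioo 0 T)), u t = 0 := by
  have hII : ∀ {a b : ℝ}, a ∈ Set.Icc 0 T → b ∈ Set.Icc 0 T → IntervalIntegrable u volume a b :=
    fun ha hb => intervalIntegrable_of_integrableOn_Ioo hu ha hb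
  have h0 : (0 : ℝ) ∈ Set.Icc 0 T := ⟨le_rfl, hT.le⟩
  set x : ℝ → V := fun t => ∫ s in 0..t, u s with hx
  have hxc : ContinuousOn x (Set.Icc 0 T) := by
    have h1 : IntegrableOn u (Set.uIcc 0 T) := by
      rw [Set.uIcc_of_le hT.le, integrableOn_Icc_iff_integrableOn_Ioo]
      exact hu
    have := intervalIntegral.continuousOn_primitive_interval h1
    rwa [Set.uIcc_of_le hT.le] at this
  -- Integrating the equation once more: J x is the primitive of J u = -B x, which is continuous, so
  -- J x is differentiable on (0, T).
  have hJx : ∀ t ∈ Set.Icc 0 T, J (x t) = ∫ s in 0..t, -B (x s) := by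
    intro t ht
    rw [hx]
    simp only
    rw [← ContinuousLinearMap.intervalIntegral_comp_comm J (hII h0 ht)]
    refine intervalIntegral.integral_congr_ae ?_
    rw [ae_restrict_iff' measurableSet_Ioo] at h
    have hne : ∀ᵐ s : ℝ, s ≠ T := by
      simp [ae_iff, measure_singleton]
    filter_upwards [h, hne] with s hs hsT hst
    rw [Set.uIoc_of_le ht.1] at hst
    exact hs ⟨hst.1, lt_of_le_of_ne (hst.2.trans ht.2) hsT⟩
  have hxat : ∀ t ∈ Set.Ioo 0 T, ContinuousAt x t := fun t ht =>
    hxc.continuousAt (Icc_mem_nhds ht.1 ht.2)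
  have hder : ∀ t ∈ Set.Ioo 0 T, HasDerivAt (fun s => J (x s)) (-B (x t)) t := by
    intro t ht
    have hco : ContinuousOn (fun s => -B (x s)) (Set.Icc 0 T) :=
      (B.continuous.comp_continuousOn hxc).neg
    have h1 : HasDerivAt (fun t => ∫ s in 0..t, -B (x s)) (-B (x t)) t := by
      refine intervalIntegral.integral_hasDerivAt_right ?_ ?_
        (hco.continuousAt (Icc_mem_nhds ht.1 ht.2))
      · refine (hco.mono ?_).intervalIntegrable
        rw [Set.uIcc_of_le ht.1.le]
        exact Set.Icc_subset_Icc le_rfl ht.2.le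
      · exact (hco.mono Set.Ioo_subset_Icc_self).stronglyMeasurableAtFilter isOpen_Ioo t ht
    refine h1.congr_of_eventuallyEq ?_
    filter_upwards [Icc_mem_nhds ht.1 ht.2] with s hs using hJx s hs
  have hQ : ∀ t ∈ Set.Ioo 0 T,
      HasDerivAt (fun s => ‖j (x s)‖ ^ 2) (2 * ⟪-B (x t), x t⟫_ℝ) t := fun t ht =>
    hasDerivAt_norm_sq_of_hasDerivAt hJ (hxat t ht) (hder t ht)
  -- Gronwall's argument: the weight e^{-2c₃t} absorbs the term c₃‖j x‖² of the lower bound on ⟨B x,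
  -- x⟩.
  have hanti : AntitoneOn (fun t => Real.exp (-(2 * c₃) * t) * ‖j (x t)‖ ^ 2) (Set.Icc 0 T) := by
    refine antitoneOn_of_deriv_nonpos (convex_Icc 0 T) ?_ ?_ ?_
    · exact (Continuous.continuousOn (by fun_prop)).mul
        ((j.continuous.comp_continuousOn hxc).norm.pow 2)
    · intro t ht
      rw [interior_Icc] at ht
      exact (DifferentiableAt.mul (by fun_prop)
        (hQ t ht).differentiableAt).differentiableWithinAt
    · intro t ht
      rw [interior_Icc] at ht
      have he : HasDerivAt (fun t => Real.exp (-(2 * c₃) * t))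
          (Real.exp (-(2 * c₃) * t) * (-(2 * c₃) * 1)) t :=
        ((hasDerivAt_id t).const_mul _).exp
      have hm : HasDerivAt (fun t => Real.exp (-(2 * c₃) * t) * ‖j (x t)‖ ^ 2) _ t :=
        he.mul (hQ t ht)
      rw [hm.deriv, inner_neg_left]
      have h1 := hB (x t)
      have h2 := Real.exp_pos (-(2 * c₃) * t)
      have h3 : 0 ≤ c₂ * ‖x t‖ ^ 2 := by positivity
      have h4 : Real.exp (-(2 * c₃) * t) * (-(2 * c₃) * 1) * ‖j (x t)‖ ^ 2
          + Real.exp (-(2 * c₃) * t) * (2 * -⟪B (x t), x t⟫_ℝ)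
          = -(2 * Real.exp (-(2 * c₃) * t) * (c₃ * ‖j (x t)‖ ^ 2 + ⟪B (x t), x t⟫_ℝ)) := by ring
      rw [h4, neg_nonpos]
      have h5 : 0 ≤ c₃ * ‖j (x t)‖ ^ 2 + ⟪B (x t), x t⟫_ℝ := by linarith
      positivity
  have hj0 : ∀ t ∈ Set.Icc 0 T, ‖j (x t)‖ ^ 2 = 0 := by
    intro t ht
    have h1 := hanti h0 ht ht.1
    simp only [hx, intervalIntegral.integral_same, map_zero, norm_zero] at h1
    have h2 := Real.exp_pos (-(2 * c₃) * t)
    have h3 : 0 ≤ ‖j (x t)‖ ^ 2 := by positivity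
    have h4 : Real.exp (-(2 * c₃) * t) * ‖j (x t)‖ ^ 2 ≤ 0 := by simpa [hx] using h1
    nlinarith
  -- Injectivity of j is not needed: ‖j x‖² vanishes identically, so its derivative -2⟨B x, x⟩ does
  -- too, and coercivity with j x = 0 forces x = 0.
  have hx0 : ∀ t ∈ Set.Ioo 0 T, x t = 0 := by
    intro t ht
    have h1 : HasDerivAt (fun s => ‖j (x s)‖ ^ 2) 0 t := by
      refine (hasDerivAt_const t (0 : ℝ)).congr_of_eventuallyEq ?_
      filter_upwards [Icc_mem_nhds ht.1 ht.2] with s hs using hj0 s hs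
    have h2 := h1.unique (hQ t ht)
    have h3 := hB (x t)
    rw [hj0 t (Set.Ioo_subset_Icc_self ht)] at h3
    rw [inner_neg_left] at h2
    have h4 : ‖x t‖ ^ 2 ≤ 0 := by
      by_contra hlt
      have := mul_pos hc₂ (not_le.1 hlt)
      linarith
    have h5 : ‖x t‖ = 0 := by nlinarith [norm_nonneg (x t)]
    exact norm_eq_zero.1 h5
  have hTm : T ∈ Set.Icc 0 T := ⟨hT.le, le_rfl⟩
  have hxT : x T = 0 := by
    have h1 : Tendsto x (𝓝[Set.Ioo 0 T] T) (𝓝 (x T)) :=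
      (hxc T hTm).mono_left (nhdsWithin_mono _ Set.Ioo_subset_Icc_self)
    have h2 : Tendsto x (𝓝[Set.Ioo 0 T] T) (𝓝 0) := by
      refine tendsto_const_nhds.congr' ?_
      filter_upwards [self_mem_nhdsWithin] with s hs using (hx0 s hs).symm
    have : (𝓝[Set.Ioo 0 T] T).NeBot := by
      rw [← mem_closure_iff_nhdsWithin_neBot, closure_Ioo hT.ne]
      exact hTm
    exact tendsto_nhds_unique h1 h2
  refine ae_eq_zero_of_intervalIntegral_eq_zero hu fun t ht => ?_
  -- All tails of u are differences of values of x, hence zero; this determines u almost everywhere.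
  have h1 : x t + ∫ s in t..T, u s = x T :=
    intervalIntegral.integral_add_adjacent_intervals (hII h0 (Set.Ioo_subset_Icc_self ht))
      (hII (Set.Ioo_subset_Icc_self ht) hTm)
  rw [hx0 t ht, hxT, zero_add] at h1
  exact h1

theorem ae_Ioo_reflect {T : ℝ} {p : ℝ → Prop}
    (h : ∀ᵐ t ∂(volume.restrict (Set.Ioo 0 T)), p (T - t)) :
    ∀ᵐ t ∂(volume.restrict (Set.Ioo 0 T)), p t := by
  rw [ae_restrict_iff' measurableSet_Ioo] at h ⊢
  have hq := (Measure.measurePreserving_sub_left (volume : Measure ℝ) T).quasiMeasurePreserving.ae h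
  filter_upwards [hq] with t ht hm
  have := ht ⟨by linarith [hm.2], by linarith [hm.1]⟩
  rwa [sub_sub_cancel] at this

theorem integrableOn_Ioo_reflect {E : Type*} [NormedAddCommGroup E] {T : ℝ} {u : ℝ → E}
    (hu : IntegrableOn u (Set.Ioo 0 T)) : IntegrableOn (fun t => u (T - t)) (Set.Ioo 0 T) := by
  have h1 := (Measure.measurePreserving_sub_left (volume : Measure ℝ) T).integrableOn_comp_preimage
    (Homeomorph.subLeft T).measurableEmbedding (f := u) (s := Set.Ioo 0 T)
  have h2 : (fun x : ℝ => T - x) ⁻¹' Set.Ioo 0 T = Set.Ioo 0 T := by simp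
  rw [h2] at h1
  exact h1.2 hu

/-- The time-reversed version of `ae_eq_zero_of_eq_neg_integral`. -/
theorem ae_eq_zero_of_eq_neg_tail [CompleteSpace V]
    (hJ : ∀ x y, ⟪J x, y⟫_ℝ = ⟪j x, j y⟫_ℝ) (hc₂ : 0 < c₂)
    (hB : ∀ x, c₂ * ‖x‖ ^ 2 - c₃ * ‖j x‖ ^ 2 ≤ ⟪B x, x⟫_ℝ) {T : ℝ} (hT : 0 < T) {u : ℝ → V}
    (hu : IntegrableOn u (Set.Ioo 0 T))
    (h : ∀ᵐ t ∂(volume.restrict (Set.Ioo 0 T)), J (u t) = -B (∫ s in t..T, u s)) :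
    ∀ᵐ t ∂(volume.restrict (Set.Ioo 0 T)), u t = 0 := by
  refine ae_Ioo_reflect (ae_eq_zero_of_eq_neg_integral hJ hc₂ hB hT
    (integrableOn_Ioo_reflect hu) ?_)
  -- Reflecting the hypothesis a second time returns it to the original time variable, where the
  -- substitution s ↦ T - s identifies the integrals.
  refine ae_Ioo_reflect (p := fun t => J (u (T - t)) = -B (∫ s in 0..t, u (T - s))) ?_
  filter_upwards [h] with t ht
  rw [sub_sub_cancel, ht, intervalIntegral.integral_comp_sub_left (fun s => u s) T]
  simp

/-- The energy estimate for regular functions. -/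
theorem energy_estimate [CompleteSpace V] (hJ : ∀ x y, ⟪J x, y⟫_ℝ = ⟪j x, j y⟫_ℝ) (hc₂ : 0 < c₂)
    (hB : ∀ x, c₂ * ‖x‖ ^ 2 - c₃ * ‖j x‖ ^ 2 ≤ ⟪B x, x⟫_ℝ) {y : ℝ → V} (hy : Continuous y) (v : V)
    {t : ℝ} (ht : 0 ≤ t) :
    Real.exp (-(2 * c₃) * t) * ‖j (v + ∫ s in 0..t, y s)‖ ^ 2
      + c₂ * ∫ s in 0..t, Real.exp (-(2 * c₃) * s) * ‖v + ∫ r in 0..s, y r‖ ^ 2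
    ≤ ‖j v‖ ^ 2 + c₂⁻¹ * ∫ s in 0..t, Real.exp (-(2 * c₃) * s) *
        ‖J (y s) + B (v + ∫ r in 0..s, y r)‖ ^ 2 := by
  set x : ℝ → V := fun t => v + ∫ s in 0..t, y s with hx
  have hxd : ∀ t, HasDerivAt x (y t) t := fun t => hasDerivAt_primitive hy v t
  have hxc : Continuous x := continuous_iff_continuousAt.2 fun t => (hxd t).continuousAt
  set e : ℝ → ℝ := fun t => Real.exp (-(2 * c₃) * t) with he
  have hec : Continuous e := by fun_prop
  have hed : ∀ t, HasDerivAt e (e t * (-(2 * c₃) * 1)) t := fun t =>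
    ((hasDerivAt_id t).const_mul _).exp
  have hQ : ∀ t, HasDerivAt (fun s => ‖j (x s)‖ ^ 2) (2 * ⟪J (y t), x t⟫_ℝ) t := fun t =>
    hasDerivAt_norm_sq_of_hasDerivAt hJ hxc.continuousAt (J.hasFDerivAt.comp_hasDerivAt t (hxd t))
  have hI : ∀ {k : ℝ → ℝ}, Continuous k → ∀ t, HasDerivAt (fun t => ∫ s in 0..t, k s) (k t) t :=
    fun hk t => intervalIntegral.integral_hasDerivAt_right (hk.intervalIntegrable _ _)
      (hk.stronglyMeasurableAtFilter _ _) hk.continuousAt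
  have hk1 : Continuous fun s => e s * ‖x s‖ ^ 2 := by fun_prop
  have hk2 : Continuous fun s => e s * ‖J (y s) + B (x s)‖ ^ 2 := by fun_prop
  -- The weight cancels the c₃ term. Of the 2c₂‖x‖² supplied by coercivity, one half is spent on
  -- Young's inequality below and the other stays on the left of the estimate.
  have hanti : Antitone fun t => e t * ‖j (x t)‖ ^ 2 + c₂ * (∫ s in 0..t, e s * ‖x s‖ ^ 2)
      - c₂⁻¹ * ∫ s in 0..t, e s * ‖J (y s) + B (x s)‖ ^ 2 := by
    refine antitone_of_hasDerivAt_nonpos (fun t => (((hed t).mul (hQ t)).add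
      ((hI hk1 t).const_mul c₂)).sub ((hI hk2 t).const_mul c₂⁻¹)) fun t => ?_
    have h1 := hB (x t)
    have h2 : 0 < e t := Real.exp_pos _
    have h3 : ⟪J (y t), x t⟫_ℝ = ⟪J (y t) + B (x t), x t⟫_ℝ - ⟪B (x t), x t⟫_ℝ := by
      rw [inner_add_left]; ring
    have h4 : ⟪J (y t) + B (x t), x t⟫_ℝ ≤ ‖J (y t) + B (x t)‖ * ‖x t‖ := real_inner_le_norm _ _
    set F := ‖J (y t) + B (x t)‖
    set X := ‖x t‖
    have h5 : 2 * (F * X) ≤ c₂⁻¹ * F ^ 2 + c₂ * X ^ 2 := by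
      have : 0 ≤ c₂⁻¹ * (F - c₂ * X) ^ 2 := by positivity
      have h6 : c₂⁻¹ * (F - c₂ * X) ^ 2 = c₂⁻¹ * F ^ 2 + c₂ * X ^ 2 - 2 * (F * X) := by
        field_simp
        ring
      linarith
    have h7 : e t * (-(2 * c₃) * 1) * ‖j (x t)‖ ^ 2 + e t * (2 * ⟪J (y t), x t⟫_ℝ)
        + c₂ * (e t * X ^ 2) - c₂⁻¹ * (e t * F ^ 2)
        = e t * (-(2 * c₃) * ‖j (x t)‖ ^ 2 + 2 * ⟪J (y t), x t⟫_ℝ + c₂ * X ^ 2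
          - c₂⁻¹ * F ^ 2) := by ring
    rw [h7]
    refine mul_nonpos_of_nonneg_of_nonpos h2.le ?_
    rw [h3]
    linarith
  have h1 := hanti ht
  simp only [intervalIntegral.integral_same, hx, he] at h1
  simp only [mul_zero, sub_zero, add_zero, Real.exp_zero, one_mul] at h1
  linarith


/-! ### Regular functions, the a priori bound and density of right-hand sides. -/

theorem memLp_Ioo_of_continuous {E : Type*} [NormedAddCommGroup E] {x : ℝ → E} (hx : Continuous x)
    (T : ℝ) : MemLp x 2 (volume.restrict (Set.Ioo 0 T)) := by
  obtain ⟨C, hC⟩ := isCompact_Icc.exists_bound_of_continuousOn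
    (hx.continuousOn (s := Set.Icc 0 T))
  refine MemLp.of_bound hx.aestronglyMeasurable C ?_
  filter_upwards [ae_restrict_mem measurableSet_Ioo] with t ht
  exact hC t (Set.Ioo_subset_Icc_self ht)

/-- The class in `L²(0, T; E)` of a continuous function. -/
def contToLp {E : Type*} [NormedAddCommGroup E] (T : ℝ) (x : C(ℝ, E)) :
    Lp E 2 (volume.restrict (Set.Ioo 0 T)) :=
  (memLp_Ioo_of_continuous x.continuous T).toLp

theorem coeFn_contToLp {E : Type*} [NormedAddCommGroup E] (T : ℝ) (x : C(ℝ, E)) :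
    contToLp T x =ᵐ[volume.restrict (Set.Ioo 0 T)] x :=
  MemLp.coeFn_toLp _

theorem norm_sq_contToLp (T : ℝ) (x : C(ℝ, V)) :
    ‖contToLp T x‖ ^ 2 = ∫ t in Set.Ioo 0 T, ‖x t‖ ^ 2 := by
  rw [← real_inner_self_eq_norm_sq, L2.inner_def]
  refine integral_congr_ae ?_
  filter_upwards [coeFn_contToLp T x] with t ht
  rw [ht, real_inner_self_eq_norm_sq]

theorem contToLp_sub {E : Type*} [NormedAddCommGroup E] (T : ℝ) (x y : C(ℝ, E)) :
    contToLp T (x - y) = contToLp T x - contToLp T y := rfl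

theorem continuous_primitive_add [CompleteSpace V] {y : ℝ → V} (hy : Continuous y) (v : V) :
    Continuous fun t => v + ∫ s in 0..t, y s :=
  continuous_iff_continuousAt.2 fun t => (hasDerivAt_primitive hy v t).continuousAt

/-- The primitive of `y` with value `v` at time `0`. -/
def primitiveFrom [CompleteSpace V] (v : V) (y : C(ℝ, V)) : C(ℝ, V) :=
  ⟨fun t => v + ∫ s in 0..t, y s, continuous_primitive_add y.continuous v⟩

theorem primitiveFrom_apply [CompleteSpace V] (v : V) (y : C(ℝ, V)) (t : ℝ) :
    primitiveFrom v y t = v + ∫ s in 0..t, y s := rfl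

theorem primitiveFrom_add [CompleteSpace V] (v v' : V) (y y' : C(ℝ, V)) :
    primitiveFrom (v + v') (y + y') = primitiveFrom v y + primitiveFrom v' y' := by
  ext t
  simp only [primitiveFrom_apply, ContinuousMap.add_apply]
  rw [intervalIntegral.integral_add (y.continuous.intervalIntegrable _ _)
    (y'.continuous.intervalIntegrable _ _)]
  abel

theorem primitiveFrom_smul [CompleteSpace V] (r : ℝ) (v : V) (y : C(ℝ, V)) :
    primitiveFrom (r • v) (r • y) = r • primitiveFrom v y := by
  ext t
  simp only [primitiveFrom_apply, ContinuousMap.smul_apply]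
  rw [intervalIntegral.integral_smul, smul_add]

variable (J B) in
/-- The operator `x ↦ J x' + B x`, in terms of `x(0) = v` and `x' = y`. -/
def evolutionMap [CompleteSpace V] : V × C(ℝ, V) →ₗ[ℝ] C(ℝ, V) where
  toFun p := (J : C(V, V)).comp p.2 + (B : C(V, V)).comp (primitiveFrom p.1 p.2)
  map_add' p q := by
    ext t
    simp [primitiveFrom_add]
    abel
  map_smul' r p := by
    ext t
    simp [primitiveFrom_smul]

theorem evolutionMap_apply [CompleteSpace V] (v : V) (y : C(ℝ, V)) (t : ℝ) :
    evolutionMap J B (v, y) t = J (y t) + B (primitiveFrom v y t) := rfl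

/-- On [0, T] the exponential weight lies between e^{-2c₃T} and 1, so the weighted energy estimate
becomes bounds in L²(0,T;V) and uniformly in H. The constant depends neither on v nor on y, so the
bounds can be applied to differences of approximations. -/
theorem exists_energy_bound [CompleteSpace V] (hJ : ∀ x y, ⟪J x, y⟫_ℝ = ⟪j x, j y⟫_ℝ) (hc₂ : 0 < c₂)
    (hc₃ : 0 ≤ c₃) (hB : ∀ x, c₂ * ‖x‖ ^ 2 - c₃ * ‖j x‖ ^ 2 ≤ ⟪B x, x⟫_ℝ) {T : ℝ} (hT : 0 < T) :
    ∃ K, 0 ≤ K ∧ ∀ v y,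
      ‖contToLp T (primitiveFrom v y)‖ ≤ K * (‖j v‖ + ‖contToLp T (evolutionMap J B (v, y))‖) ∧
      ∀ t ∈ Set.Icc 0 T,
        ‖j (primitiveFrom v y t)‖ ≤ K * (‖j v‖ + ‖contToLp T (evolutionMap J B (v, y))‖) := by
  set q := Real.exp (-(2 * c₃) * T) with hq
  have hq0 : 0 < q := Real.exp_pos _
  set M := max 1 c₂⁻¹ with hM
  set N := min 1 c₂ with hN
  have hN0 : 0 < N := lt_min one_pos hc₂
  have hM1 : 1 ≤ M := le_max_left _ _
  -- M bounds both coefficients on the right of the energy estimate, N is a lower bound for those on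
  -- the left, and q is the smallest value of the weight.
  refine ⟨√(M / (N * q)), Real.sqrt_nonneg _, fun v y => ?_⟩
  set x := primitiveFrom v y with hx
  set f := evolutionMap J B (v, y) with hf
  have hF : ‖contToLp T f‖ ^ 2 = ∫ t in 0..T, ‖f t‖ ^ 2 := by
    rw [norm_sq_contToLp, setIntegral_Ioo_eq_intervalIntegral hT.le]
  have hX : ‖contToLp T x‖ ^ 2 = ∫ t in 0..T, ‖x t‖ ^ 2 := by
    rw [norm_sq_contToLp, setIntegral_Ioo_eq_intervalIntegral hT.le]
  have key : ∀ t ∈ Set.Icc 0 T, q * ‖j (x t)‖ ^ 2 + c₂ * (q * ∫ s in 0..t, ‖x s‖ ^ 2)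
      ≤ M * (‖j v‖ ^ 2 + ‖contToLp T f‖ ^ 2) := by
    intro t ht
    have h1 := energy_estimate hJ hc₂ hB y.continuous v ht.1
    have hexp : ∀ s ∈ Set.Icc 0 t, q ≤ Real.exp (-(2 * c₃) * s) ∧ Real.exp (-(2 * c₃) * s) ≤ 1 := by
      intro s hs
      constructor
      · rw [hq, Real.exp_le_exp]
        have : c₃ * s ≤ c₃ * T := mul_le_mul_of_nonneg_left (hs.2.trans ht.2) hc₃
        linarith
      · rw [Real.exp_le_one_iff]
        have := mul_nonneg hc₃ hs.1
        linarith
    have h2 : q * ∫ s in 0..t, ‖x s‖ ^ 2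
        ≤ ∫ s in 0..t, Real.exp (-(2 * c₃) * s) * ‖x s‖ ^ 2 := by
      rw [← intervalIntegral.integral_const_mul]
      refine intervalIntegral.integral_mono_on ht.1
        (Continuous.intervalIntegrable (by fun_prop) _ _)
        (Continuous.intervalIntegrable (by fun_prop) _ _) fun s hs => ?_
      exact mul_le_mul_of_nonneg_right (hexp s hs).1 (by positivity)
    have h3 : ∫ s in 0..t, Real.exp (-(2 * c₃) * s) * ‖f s‖ ^ 2 ≤ ‖contToLp T f‖ ^ 2 := by
      rw [hF]
      calc ∫ s in 0..t, Real.exp (-(2 * c₃) * s) * ‖f s‖ ^ 2 ≤ ∫ s in 0..t, ‖f s‖ ^ 2 := by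
            refine intervalIntegral.integral_mono_on ht.1
              (Continuous.intervalIntegrable (by fun_prop) _ _)
              (Continuous.intervalIntegrable (by fun_prop) _ _) fun s hs => ?_
            exact mul_le_of_le_one_left (by positivity) (hexp s hs).2
        _ ≤ ∫ s in 0..T, ‖f s‖ ^ 2 := by
            refine intervalIntegral.integral_mono_interval le_rfl ht.1 ht.2
              (Eventually.of_forall fun s => by positivity)
              (Continuous.intervalIntegrable (by fun_prop) _ _)
    have h4 : q * ‖j (x t)‖ ^ 2 ≤ Real.exp (-(2 * c₃) * t) * ‖j (x t)‖ ^ 2 :=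
      mul_le_mul_of_nonneg_right (hexp t ⟨ht.1, le_rfl⟩).1 (by positivity)
    have h5 : c₂⁻¹ * ∫ s in 0..t, Real.exp (-(2 * c₃) * s) * ‖f s‖ ^ 2
        ≤ M * ‖contToLp T f‖ ^ 2 :=
      (mul_le_mul_of_nonneg_left h3 (by positivity)).trans
        (mul_le_mul_of_nonneg_right (le_max_right _ _) (by positivity))
    have h6 : ‖j v‖ ^ 2 ≤ M * ‖j v‖ ^ 2 := le_mul_of_one_le_left (by positivity) hM1
    have h7 := mul_le_mul_of_nonneg_left h2 hc₂.le
    have h8 : Real.exp (-(2 * c₃) * t) * ‖j (x t)‖ ^ 2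
        + c₂ * ∫ s in 0..t, Real.exp (-(2 * c₃) * s) * ‖x s‖ ^ 2
        ≤ ‖j v‖ ^ 2 + c₂⁻¹ * ∫ s in 0..t, Real.exp (-(2 * c₃) * s) * ‖f s‖ ^ 2 := h1
    linarith
  have fin : ∀ r : ℝ, 0 ≤ r → N * q * r ^ 2 ≤ M * (‖j v‖ ^ 2 + ‖contToLp T f‖ ^ 2) →
      r ≤ √(M / (N * q)) * (‖j v‖ + ‖contToLp T f‖) := by
    intro r hr h
    rw [← Real.sqrt_sq (show 0 ≤ ‖j v‖ + ‖contToLp T f‖ by positivity), ← Real.sqrt_mul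
      (by positivity)]
    refine Real.le_sqrt_of_sq_le ?_
    rw [div_mul_eq_mul_div, le_div_iff₀ (by positivity)]
    have h1 : ‖j v‖ ^ 2 + ‖contToLp T f‖ ^ 2 ≤ (‖j v‖ + ‖contToLp T f‖) ^ 2 := by
      have := mul_nonneg (norm_nonneg (j v)) (norm_nonneg (contToLp T f))
      linarith [add_sq ‖j v‖ ‖contToLp T f‖]
    have h2 := mul_le_mul_of_nonneg_left h1 (zero_le_one.trans hM1)
    linarith
  refine ⟨fin _ (norm_nonneg _) ?_, fun t ht => fin _ (norm_nonneg _) ?_⟩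
  · have h1 := key T ⟨hT.le, le_rfl⟩
    rw [← hX] at h1
    have h2 : N * (q * ‖contToLp T x‖ ^ 2) ≤ c₂ * (q * ‖contToLp T x‖ ^ 2) :=
      mul_le_mul_of_nonneg_right (min_le_right _ _) (by positivity)
    have h3 : 0 ≤ q * ‖j (x T)‖ ^ 2 := by positivity
    linarith
  · have h1 := key t ht
    have h2 : N * (q * ‖j (x t)‖ ^ 2) ≤ 1 * (q * ‖j (x t)‖ ^ 2) :=
      mul_le_mul_of_nonneg_right (min_le_left _ _) (by positivity)
    have h3 : 0 ≤ c₂ * (q * ∫ s in 0..t, ‖x s‖ ^ 2) :=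
      mul_nonneg hc₂.le (mul_nonneg hq0.le
        (intervalIntegral.integral_nonneg ht.1 fun s _ => by positivity))
    linarith

/-- Right-hand sides attained by regular functions vanishing at time `0` are dense. -/
theorem denseRange_evolutionMap [CompleteSpace V] (hJ : ∀ x y, ⟪J x, y⟫_ℝ = ⟪j x, j y⟫_ℝ)
    (hc₂ : 0 < c₂) (hB : ∀ x, c₂ * ‖x‖ ^ 2 - c₃ * ‖j x‖ ^ 2 ≤ ⟪B x, x⟫_ℝ) {T : ℝ} (hT : 0 < T) :
    DenseRange fun y : C(ℝ, V) => contToLp T (evolutionMap J B (0, y)) := by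
  let Λ : C(ℝ, V) →ₗ[ℝ] Lp V 2 (volume.restrict (Set.Ioo 0 T)) :=
    { toFun := fun y => contToLp T (evolutionMap J B (0, y))
      map_add' := fun y y' => by
        have : ((0 : V), y + y') = (0, y) + (0, y') := by simp
        rw [this, map_add]
        rfl
      map_smul' := fun r y => by
        have : ((0 : V), r • y) = r • ((0 : V), y) := by simp
        rw [this, map_smul]
        rfl }
  change DenseRange Λ
  have hJs : ∀ x y, ⟪J x, y⟫_ℝ = ⟪x, J y⟫_ℝ := fun x y => by
    rw [hJ, real_inner_comm, ← hJ, real_inner_comm]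
  have hBs : ∀ x y, ⟪B x, y⟫_ℝ = ⟪x, B.adjoint y⟫_ℝ := fun x y => by
    rw [ContinuousLinearMap.adjoint_inner_right]
  have horth : (LinearMap.range Λ)ᗮ = ⊥ := by
    rw [Submodule.eq_bot_iff]
    intro p hp
    have hpi : IntegrableOn p (Set.Ioo 0 T) := (Lp.memLp p).integrable one_le_two
    have hJp : IntegrableOn (fun t => J (p t)) (Set.Ioo 0 T) := J.integrable_comp hpi
    have hBp : IntegrableOn (fun t => B.adjoint (p t)) (Set.Ioo 0 T) :=
      B.adjoint.integrable_comp hpi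
    have htail : IntegrableOn (fun t => ∫ s in t..T, B.adjoint (p s)) (Set.Ioo 0 T) :=
      (continuousOn_tail hT.le hBp).integrableOn_Icc.mono_set Set.Ioo_subset_Icc_self
    -- Orthogonality of p to the images of y = φ v, for scalar φ and v in V, moves J and B onto p.
    -- Fubini turns the primitive of φ into a tail integral of B* p.
    have main : ∀ᵐ t ∂(volume.restrict (Set.Ioo 0 T)),
        J (p t) + ∫ s in t..T, B.adjoint (p s) = 0 := by
      refine ae_eq_zero_of_integral_test_smul (hJp.add htail) fun φ h1 _ _ => ?_
      refine ext_inner_left ℝ fun v => ?_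
      rw [inner_zero_right]
      simp only [smul_add]
      have hΦc : Continuous fun t => ∫ s in 0..t, φ s := by
        simpa using continuous_primitive_add h1.continuous 0
      rw [integral_add (integrableOn_Ioo_smul h1.continuous hJp)
        (integrableOn_Ioo_smul h1.continuous htail), ← integral_primitive_smul h1.continuous hBp,
        ← integral_add (integrableOn_Ioo_smul h1.continuous hJp)
        (integrableOn_Ioo_smul hΦc hBp),
        ← integral_inner (show Integrable (fun t => φ t • J (p t)
          + (∫ s in 0..t, φ s) • B.adjoint (p t)) _ from
          (integrableOn_Ioo_smul h1.continuous hJp).add (integrableOn_Ioo_smul hΦc hBp))]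
      have h2 := (Submodule.mem_orthogonal _ _).1 hp _
        (LinearMap.mem_range_self Λ ⟨fun t => φ t • v, h1.continuous.smul continuous_const⟩)
      rw [L2.inner_def] at h2
      refine Eq.trans ?_ h2
      refine integral_congr_ae ?_
      filter_upwards [coeFn_contToLp T (evolutionMap J B
        (0, ⟨fun t => φ t • v, h1.continuous.smul continuous_const⟩))] with t ht
      change _ = ⟪contToLp T (evolutionMap J B
        (0, ⟨fun t => φ t • v, h1.continuous.smul continuous_const⟩)) t, p t⟫_ℝ
      rw [ht, evolutionMap_apply, primitiveFrom_apply]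
      simp only [ContinuousMap.coe_mk, zero_add, map_smul, intervalIntegral.integral_smul_const,
        inner_add_left, inner_add_right, inner_smul_right, real_inner_smul_left, hJs, hBs]
    -- This is the homogeneous equation run backwards from T. The adjoint inherits coercivity
    -- because ⟨B* x, x⟩ = ⟨B x, x⟩.
    have hz := ae_eq_zero_of_eq_neg_tail (B := B.adjoint) hJ hc₂ (fun x => by
      rw [real_inner_comm, ← hBs]; exact hB x) hT hpi (by
        filter_upwards [main, ae_restrict_mem measurableSet_Ioo] with t ht htm
        rw [eq_neg_iff_add_eq_zero, ← ContinuousLinearMap.intervalIntegral_comp_comm]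
        · exact ht
        · exact intervalIntegrable_of_integrableOn_Ioo hpi (Set.Ioo_subset_Icc_self htm)
            ⟨hT.le, le_rfl⟩)
    exact (Lp.eq_zero_iff_ae_eq_zero).2 hz
  have := (Submodule.topologicalClosure_eq_top_iff (K := LinearMap.range Λ)).2 horth
  have h2 := (Submodule.dense_iff_topologicalClosure_eq_top).2 this
  rwa [LinearMap.coe_range] at h2


/-- The integral is the pairing of L²(0,T;V) with the fixed L² function φ, hence continuous in w. -/
theorem tendsto_integral_smul_Lp [CompleteSpace V] {T : ℝ} {φ : ℝ → ℝ} (hφ : Continuous φ)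
    {ι : Type*} {l : Filter ι} {w : ι → Lp V 2 (volume.restrict (Set.Ioo 0 T))}
    {w₀ : Lp V 2 (volume.restrict (Set.Ioo 0 T))} (h : Tendsto w l (𝓝 w₀)) (A : V →L[ℝ] V) :
    Tendsto (fun i => ∫ t in Set.Ioo 0 T, φ t • A (w i t)) l
      (𝓝 (∫ t in Set.Ioo 0 T, φ t • A (w₀ t))) := by
  set P := ((ContinuousLinearMap.lsmul ℝ ℝ : ℝ →L[ℝ] V →L[ℝ] V).flip.comp A).flip.lpPairing
    (volume.restrict (Set.Ioo 0 T)) 2 2 (contToLp T ⟨φ, hφ⟩)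
  have hP : ∀ w, P w = ∫ t in Set.Ioo 0 T, φ t • A (w t) := by
    intro w
    rw [ContinuousLinearMap.lpPairing_eq_integral]
    refine integral_congr_ae ?_
    filter_upwards [coeFn_contToLp T ⟨φ, hφ⟩] with t ht
    simp [ht]
  simp only [← hP]
  exact (P.continuous.tendsto _).comp h

/-- In this form the equation no longer contains y = x', only x and the right-hand side, so it
survives L² limits. -/
theorem integral_deriv_smul_evolution [CompleteSpace V] {T : ℝ} (hT : 0 < T) {ψ : ℝ → ℝ}
    (hψ : ContDiff ℝ 1 ψ) (hs : tsupport ψ ⊆ Set.Ioo 0 T) (v : V) (y : C(ℝ, V)) :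
    ∫ t in Set.Ioo 0 T, deriv ψ t • J (primitiveFrom v y t)
      = -∫ t in Set.Ioo 0 T, ψ t • (evolutionMap J B (v, y) t - B (primitiveFrom v y t)) := by
  have h1 : ∀ t, evolutionMap J B (v, y) t - B (primitiveFrom v y t) = J (y t) := fun t => by
    rw [evolutionMap_apply, add_sub_cancel_right]
  simp only [h1]
  rw [setIntegral_Ioo_eq_intervalIntegral hT.le, setIntegral_Ioo_eq_intervalIntegral hT.le,
    intervalIntegral.integral_smul_deriv_eq_deriv_smul (u := ψ)
      (v := fun t => J (primitiveFrom v y t)) (u' := deriv ψ)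
      (fun t _ => ((hψ.differentiable one_ne_zero) t).hasDerivAt)
      (fun t _ => J.hasFDerivAt.comp_hasDerivAt t (hasDerivAt_primitive y.continuous v t))
      ((hψ.continuous_deriv le_rfl).intervalIntegrable _ _)
      (Continuous.intervalIntegrable (by fun_prop) _ _),
    eq_zero_of_tsupport_subset_Ioo hs (t := 0) (by simp),
    eq_zero_of_tsupport_subset_Ioo hs (t := T) (by simp)]
  simp

/-- Existence of weak solutions of `(J u)' + B u = f`, `u(0) = g`. -/
theorem exists_weakSolution [CompleteSpace V] [CompleteSpace H] (hj : DenseRange j)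
    (hJ : ∀ x y, ⟪J x, y⟫_ℝ = ⟪j x, j y⟫_ℝ) (hc₂ : 0 < c₂) (hc₃ : 0 ≤ c₃)
    (hB : ∀ x, c₂ * ‖x‖ ^ 2 - c₃ * ‖j x‖ ^ 2 ≤ ⟪B x, x⟫_ℝ) {T : ℝ} (hT : 0 < T)
    (f : Lp V 2 (volume.restrict (Set.Ioo 0 T))) (g : H) :
    ∃ u : Lp V 2 (volume.restrict (Set.Ioo 0 T)), HasInitialValue j T u g ∧
      ∀ ψ : ℝ → ℝ, ContDiff ℝ 1 ψ → tsupport ψ ⊆ Set.Ioo 0 T →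
        ∫ t in Set.Ioo 0 T, deriv ψ t • J (u t)
          = -∫ t in Set.Ioo 0 T, ψ t • (f t - B (u t)) := by
  obtain ⟨K, hK0, hK⟩ := exists_energy_bound hJ hc₂ hc₃ hB hT
  have hpos : ∀ n : ℕ, (0 : ℝ) < 1 / ((n : ℝ) + 1) := fun n => Nat.one_div_pos_of_nat
  choose v hv using fun n : ℕ => hj.exists_dist_lt g (hpos n)
  -- Subtracting the image of the constant function v n leaves a right-hand side to be approximated
  -- with zero initial value; by linearity the image of (v n, z n) then tends to f.
  choose z hz using fun n : ℕ => (denseRange_evolutionMap hJ hc₂ hB hT).exists_dist_lt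
    (f - contToLp T (evolutionMap J B (v n, 0))) (hpos n)
  set x : ℕ → C(ℝ, V) := fun n => primitiveFrom (v n) (z n) with hx
  set F : ℕ → Lp V 2 (volume.restrict (Set.Ioo 0 T)) := fun n =>
    contToLp T (evolutionMap J B (v n, z n)) with hF
  have hFn : ∀ n, F n = contToLp T (evolutionMap J B (v n, 0))
      + contToLp T (evolutionMap J B (0, z n)) := fun n => by
    have : (v n, z n) = (v n, 0) + (0, z n) := by simp
    rw [hF]
    simp only
    rw [this, map_add]
    rfl
  have hFt : Tendsto F atTop (𝓝 f) := by
    rw [tendsto_iff_dist_tendsto_zero]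
    refine squeeze_zero (fun _ => dist_nonneg) (fun n => ?_) tendsto_one_div_add_atTop_nhds_zero_nat
    rw [hFn, dist_comm, dist_eq_norm, ← sub_sub, ← dist_eq_norm]
    exact (hz n).le
  have hvt : Tendsto (fun n => j (v n)) atTop (𝓝 g) := by
    rw [tendsto_iff_dist_tendsto_zero]
    refine squeeze_zero (fun _ => dist_nonneg) (fun n => ?_) tendsto_one_div_add_atTop_nhds_zero_nat
    rw [dist_comm]
    exact (hv n).le
  have hsub : ∀ n m, primitiveFrom (v n - v m) (z n - z m) = x n - x m := fun n m => by
    have h1 := primitiveFrom_add (v n) ((-1 : ℝ) • v m) (z n) ((-1 : ℝ) • z m)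
    rw [primitiveFrom_smul] at h1
    simpa [sub_eq_add_neg] using h1
  have hbound : ∀ n m,
      dist (contToLp T (x n)) (contToLp T (x m)) ≤ K * (dist (j (v n)) (j (v m)) + dist (F n) (F m))
      ∧ ∀ t ∈ Set.Icc 0 T,
        dist (j (x n t)) (j (x m t)) ≤ K * (dist (j (v n)) (j (v m)) + dist (F n) (F m)) := by
    intro n m
    have h1 := hK (v n - v m) (z n - z m)
    have h2 : contToLp T (evolutionMap J B (v n - v m, z n - z m)) = F n - F m := by
      have : (v n - v m, z n - z m) = (v n, z n) - (v m, z m) := rfl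
      rw [this, map_sub]
      rfl
    rw [hsub, h2, contToLp_sub, map_sub] at h1
    simpa only [dist_eq_norm, ContinuousMap.sub_apply, map_sub] using h1
  have hC : Tendsto (fun p : ℕ × ℕ => K * (dist (j (v p.1)) (j (v p.2)) + dist (F p.1) (F p.2)))
      atTop (𝓝 0) := by
    have h1 := (cauchySeq_iff_tendsto_dist_atTop_0.1 hvt.cauchySeq)
    have h2 := (cauchySeq_iff_tendsto_dist_atTop_0.1 hFt.cauchySeq)
    simpa using (h1.add h2).const_mul K
  obtain ⟨u, hu⟩ := cauchySeq_tendsto_of_complete (u := fun n => contToLp T (x n))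
    (cauchySeq_iff_tendsto_dist_atTop_0.2
      (squeeze_zero (fun _ => dist_nonneg) (fun p => (hbound p.1 p.2).1) hC))
  -- The uniform half of the energy bound gives a limit in C([0, T]; H), which becomes the
  -- continuous representative.
  let X : ℕ → C(Set.Icc 0 T, H) := fun n => ⟨fun t => j (x n t), by fun_prop⟩
  obtain ⟨U, hU⟩ := cauchySeq_tendsto_of_complete (u := X)
    (cauchySeq_iff_tendsto_dist_atTop_0.2
      (squeeze_zero (fun _ => dist_nonneg) (fun p => (ContinuousMap.dist_le (by positivity)).2
        fun t => (hbound p.1 p.2).2 t t.2) hC))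
  have hUt : ∀ t : Set.Icc 0 T, Tendsto (fun n => j (x n t)) atTop (𝓝 (U t)) := fun t =>
    ((continuous_eval_const t).tendsto U).comp hU
  refine ⟨u, ⟨Set.IccExtend hT.le U, (U.continuous.Icc_extend').continuousOn, ?_, ?_⟩, ?_⟩
  · obtain ⟨ns, hns, hae⟩ := (tendstoInMeasure_of_tendsto_Lp hu).exists_seq_tendsto_ae
    have hco : ∀ᵐ t ∂(volume.restrict (Set.Ioo 0 T)), ∀ n, contToLp T (x n) t = x n t :=
      ae_all_iff.2 fun n => coeFn_contToLp T (x n)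
    filter_upwards [hae, hco, ae_restrict_mem measurableSet_Ioo] with t h1 h2 h3
    rw [Set.IccExtend_of_mem _ _ (Set.Ioo_subset_Icc_self h3)]
    simp only [h2] at h1
    exact tendsto_nhds_unique ((j.continuous.tendsto _).comp h1)
      ((hUt ⟨t, Set.Ioo_subset_Icc_self h3⟩).comp hns.tendsto_atTop)
  · rw [Set.IccExtend_of_mem _ _ ⟨le_rfl, hT.le⟩]
    refine tendsto_nhds_unique (hUt ⟨0, le_rfl, hT.le⟩) ?_
    simpa [hx, primitiveFrom_apply] using hvt
  · intro ψ h1 h2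
    have h3 := tendsto_integral_smul_Lp (h1.continuous_deriv le_rfl) hu J
    have hI : ∀ (w : Lp V 2 (volume.restrict (Set.Ioo 0 T))) (A : V →L[ℝ] V),
        IntegrableOn (fun t => ψ t • A (w t)) (Set.Ioo 0 T) := fun w A =>
      integrableOn_Ioo_smul h1.continuous (A.integrable_comp ((Lp.memLp w).integrable one_le_two))
    have h4 := ((tendsto_integral_smul_Lp h1.continuous hFt (.id ℝ V)).sub
      (tendsto_integral_smul_Lp h1.continuous hu B)).neg
    have h5 : ∀ w w' : Lp V 2 (volume.restrict (Set.Ioo 0 T)),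
        ∫ t in Set.Ioo 0 T, ψ t • (w t - B (w' t))
          = (∫ t in Set.Ioo 0 T, ψ t • (ContinuousLinearMap.id ℝ V) (w t))
            - ∫ t in Set.Ioo 0 T, ψ t • B (w' t) := fun w w' => by
      rw [← integral_sub (hI w _) (hI w' B)]
      simp [smul_sub]
    rw [h5]
    refine tendsto_nhds_unique h3 (h4.congr fun n => ?_)
    rw [← h5]
    have h6 := integral_deriv_smul_evolution (J := J) (B := B) hT h1 h2 (v n) (z n)
    have h7 : ∫ t in Set.Ioo 0 T, deriv ψ t • J (contToLp T (x n) t)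
        = ∫ t in Set.Ioo 0 T, deriv ψ t • J (primitiveFrom (v n) (z n) t) := by
      refine integral_congr_ae ?_
      filter_upwards [coeFn_contToLp T (x n)] with t ht
      rw [ht]
    rw [h7, h6]
    congr 1
    refine integral_congr_ae ?_
    filter_upwards [coeFn_contToLp T (x n),
      coeFn_contToLp T (evolutionMap J B (v n, z n))] with t ht ht'
    rw [ht]
    simp only [hF]
    rw [ht']

/-- Uniqueness of weak solutions of `(J u)' + B u = 0`, `u(0) = 0`. -/
theorem eq_zero_of_weakSolution [CompleteSpace V]
    (hJ : ∀ x y, ⟪J x, y⟫_ℝ = ⟪j x, j y⟫_ℝ) (hc₂ : 0 < c₂)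
    (hB : ∀ x, c₂ * ‖x‖ ^ 2 - c₃ * ‖j x‖ ^ 2 ≤ ⟪B x, x⟫_ℝ) {T : ℝ} (hT : 0 < T)
    (u : Lp V 2 (volume.restrict (Set.Ioo 0 T))) (h0 : HasInitialValue j T u 0)
    (h : ∀ ψ : ℝ → ℝ, ContDiff ℝ (⊤ : ℕ∞) ψ → HasCompactSupport ψ → tsupport ψ ⊆ Set.Ioo 0 T →
        ∫ t in Set.Ioo 0 T, deriv ψ t • J (u t) = -∫ t in Set.Ioo 0 T, ψ t • -B (u t)) :
    u = 0 := by
  have hu : IntegrableOn u (Set.Ioo 0 T) := (Lp.memLp u).integrable one_le_two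
  have hJu : IntegrableOn (fun t => J (u t)) (Set.Ioo 0 T) := J.integrable_comp hu
  have hBu : IntegrableOn (fun t => -B (u t)) (Set.Ioo 0 T) := (B.integrable_comp hu).neg
  obtain ⟨c, hc⟩ := exists_ae_eq_sub_integral hT hBu hJu h
  obtain ⟨U, hUc, hUu, hU0⟩ := h0
  have hTm : T ∈ Set.Icc 0 T := ⟨hT.le, le_rfl⟩
  have h0m : (0 : ℝ) ∈ Set.Icc 0 T := ⟨le_rfl, hT.le⟩
  have hcont : ∀ w, ContinuousOn (fun t => ⟪c - ∫ s in t..T, -B (u s), w⟫_ℝ - ⟪U t, j w⟫_ℝ)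
      (Set.Icc 0 T) := fun w =>
    ((continuousOn_const.sub (continuousOn_tail hT.le hBu)).inner continuousOn_const).sub
      (hUc.inner continuousOn_const)
  -- The constant is fixed by the initial value. J u and U live in different spaces but satisfy ⟨J
  -- u, w⟩ = ⟨U, j w⟩; both sides have continuous versions, so the identity extends to t = 0, where
  -- U vanishes.
  have hc0 : c = ∫ s in 0..T, -B (u s) := by
    refine ext_inner_right ℝ fun w => ?_
    have hz : ∀ᵐ t ∂(volume.restrict (Set.Ioo 0 T)),
        ⟪c - ∫ s in t..T, -B (u s), w⟫_ℝ - ⟪U t, j w⟫_ℝ = 0 := by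
      filter_upwards [hc, hUu] with t h1 h2
      rw [← h1, ← h2, hJ, sub_self]
    have hall : Set.EqOn (fun t => ⟪c - ∫ s in t..T, -B (u s), w⟫_ℝ - ⟪U t, j w⟫_ℝ) (fun _ => 0)
        (Set.Icc 0 T) := by
      have hae : (fun t => ⟪c - ∫ s in t..T, -B (u s), w⟫_ℝ - ⟪U t, j w⟫_ℝ)
          =ᵐ[volume.restrict (Set.Icc 0 T)] fun _ => 0 := by
        rw [← restrict_Ioo_eq_restrict_Icc]
        exact hz
      exact Measure.eqOn_Icc_of_ae_eq volume hT.ne hae (hcont w) continuousOn_const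
    have h1 := hall h0m
    simp only [hU0, inner_zero_left, sub_zero, inner_sub_left] at h1
    linarith
  have hz := ae_eq_zero_of_eq_neg_integral hJ hc₂ hB hT hu (by
    filter_upwards [hc, ae_restrict_mem measurableSet_Ioo] with t ht htm
    have htI := Set.Ioo_subset_Icc_self htm
    rw [ht, hc0, ← intervalIntegral.integral_add_adjacent_intervals
      (intervalIntegrable_of_integrableOn_Ioo hBu h0m htI)
      (intervalIntegrable_of_integrableOn_Ioo hBu htI hTm), add_sub_cancel_right,
      intervalIntegral.integral_neg, ContinuousLinearMap.intervalIntegral_comp_comm B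
      (intervalIntegrable_of_integrableOn_Ioo hu h0m htI)])
  exact (Lp.eq_zero_iff_ae_eq_zero).2 hz

/-! ### From V* to V by the Riesz isomorphism. -/

/-- Well-posedness of the parabolic equation for a bilinear form satisfying a Gårding
inequality. -/
theorem existsUnique_isParabolicSolution [CompleteSpace V] [CompleteSpace H] {j : V →L[ℝ] H}
    (hj : DenseRange j) {a : V →L[ℝ] V →L[ℝ] ℝ} (ha : GardingInequality j a) {T : ℝ} (hT : 0 < T)
    (f : Lp (StrongDual ℝ V) 2 (volume.restrict (Set.Ioo 0 T))) (g : H) :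
    ∃! u, IsParabolicSolution j a T f g u := by
  obtain ⟨c₂, hc₂, c₃, hc₃, hG⟩ := ha
  let R : V ≃L[ℝ] StrongDual ℝ V := (InnerProductSpace.toDual ℝ V).toContinuousLinearEquiv
  have hR : ∀ l w, ⟪R.symm l, w⟫_ℝ = l w := fun l w => InnerProductSpace.toDual_symm_apply
  let G : V →L[ℝ] StrongDual ℝ V :=
    ((ContinuousLinearMap.compL ℝ V H ℝ).flip j).comp ((innerSL ℝ : H →L[ℝ] H →L[ℝ] ℝ).comp j)
  have hGm : ∀ x, G x = gelfandMap j x := fun _ => rfl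
  let J : V →L[ℝ] V := (R.symm : StrongDual ℝ V →L[ℝ] V).comp G
  let B : V →L[ℝ] V := (R.symm : StrongDual ℝ V →L[ℝ] V).comp a
  have hJ : ∀ x y, ⟪J x, y⟫_ℝ = ⟪j x, j y⟫_ℝ := fun x y => hR _ _
  have hB : ∀ x, c₂ * ‖x‖ ^ 2 - c₃ * ‖j x‖ ^ 2 ≤ ⟪B x, x⟫_ℝ := fun x => by
    rw [show ⟪B x, x⟫_ℝ = a x x from hR _ _]
    exact hG x
  have hRJ : ∀ x, R (J x) = gelfandMap j x := fun x => R.apply_symm_apply _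
  have hRB : ∀ x, R (B x) = a x := fun x => R.apply_symm_apply _
  have transfer : ∀ (ψ : ℝ → ℝ) (p : ℝ → V),
      ∫ t in Set.Ioo 0 T, ψ t • R (p t) = R (∫ t in Set.Ioo 0 T, ψ t • p t) := fun ψ p => by
    rw [← ContinuousLinearEquiv.integral_comp_comm]
    simp
  refine existsUnique_of_exists_of_unique ?_ ?_
  · obtain ⟨u, hu0, hu⟩ := exists_weakSolution hj hJ hc₂ hc₃ hB hT
      ((R.symm : StrongDual ℝ V →L[ℝ] V).compLp f) g
    -- Applying R to the weak equation in V recovers the distributional equation in V*.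
    have hderiv : HasTimeDeriv j T u (f - a.compLp u) := by
      intro φ
      have h1 := hu φ (φ.contDiff.of_le (by exact_mod_cast le_top)) φ.tsupport_subset
      simp only [← hRJ]
      rw [transfer, h1, map_neg, ← transfer]
      congr 1
      refine integral_congr_ae ?_
      filter_upwards [Lp.coeFn_sub f (a.compLp u), a.coeFn_compLp u,
        (R.symm : StrongDual ℝ V →L[ℝ] V).coeFn_compLp f] with t h2 h3 h4
      rw [h2, Pi.sub_apply, h3, h4, map_sub, hRB]
      congr 2
      exact R.apply_symm_apply _
    refine ⟨u, ⟨_, hderiv⟩, ⟨_, hderiv, ?_⟩, hu0⟩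
    filter_upwards [Lp.coeFn_sub f (a.compLp u), a.coeFn_compLp u] with t h2 h3
    rw [h2, Pi.sub_apply, h3, sub_add_cancel]
  · rintro u u' ⟨-, ⟨w, hw, he⟩, ⟨U, hUc, hUu, hU0⟩⟩ ⟨-, ⟨w', hw', he'⟩, ⟨U', hUc', hUu', hU0'⟩⟩
    have hI : ∀ z : Lp V 2 (volume.restrict (Set.Ioo 0 T)), IntegrableOn z (Set.Ioo 0 T) :=
      fun z => (Lp.memLp z).integrable one_le_two
    have hI' : ∀ z : Lp (StrongDual ℝ V) 2 (volume.restrict (Set.Ioo 0 T)),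
      IntegrableOn z (Set.Ioo 0 T) := fun z => (Lp.memLp z).integrable one_le_two
    rw [← sub_eq_zero]
    -- The difference has zero initial value and solves the homogeneous equation, which is checked
    -- in V* because R is injective.
    refine eq_zero_of_weakSolution hJ hc₂ hB hT (u - u') ⟨fun t => U t - U' t, hUc.sub hUc', ?_, by
      beta_reduce; rw [hU0, hU0', sub_self]⟩ fun ψ h1 h2 h3 => R.injective ?_
    · filter_upwards [hUu, hUu', Lp.coeFn_sub u u'] with t e1 e2 e3
      rw [e3, Pi.sub_apply, map_sub, e1, e2]
    · have hc : Continuous (deriv ψ) := h1.continuous_deriv (by exact_mod_cast le_top)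
      have k1 := hw ⟨ψ, h1, h2, h3⟩
      have k2 := hw' ⟨ψ, h1, h2, h3⟩
      rw [map_neg, ← transfer, ← transfer]
      have e1 : ∫ t in Set.Ioo 0 T, deriv ψ t • R (J ((u - u' : Lp V 2 _) t))
          = (∫ t in Set.Ioo 0 T, deriv ψ t • gelfandMap j (u t))
            - ∫ t in Set.Ioo 0 T, deriv ψ t • gelfandMap j (u' t) := by
        simp only [← hGm]
        rw [← integral_sub (integrableOn_Ioo_smul hc (G.integrable_comp (hI u)))
          (integrableOn_Ioo_smul hc (G.integrable_comp (hI u')))]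
        refine integral_congr_ae ?_
        filter_upwards [Lp.coeFn_sub u u'] with t e3
        rw [e3, Pi.sub_apply, map_sub, map_sub, hRJ, hRJ, smul_sub, hGm, hGm]
      have e2 : ∫ t in Set.Ioo 0 T, ψ t • R (-B ((u - u' : Lp V 2 _) t))
          = (∫ t in Set.Ioo 0 T, ψ t • w t) - ∫ t in Set.Ioo 0 T, ψ t • w' t := by
        rw [← integral_sub (integrableOn_Ioo_smul h1.continuous (hI' w))
          (integrableOn_Ioo_smul h1.continuous (hI' w'))]
        refine integral_congr_ae ?_
        filter_upwards [Lp.coeFn_sub u u', he, he'] with t e3 e4 e5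
        rw [e3, Pi.sub_apply, map_neg, hRB, map_sub, ← smul_sub]
        congr 1
        rw [eq_sub_of_add_eq e4, eq_sub_of_add_eq e5]
        abel
      rw [e1, e2]
      rw [TestFunction.coe_mk] at k1 k2
      rw [k1, k2]
      abel

end Evolution

/-! ### Fourier inversion, differentiation, translation and Parseval for test functions. -/

section InverseHat

variable {d : ℕ}

/-- The inverse `g ↦ (2π)^{-d} ∫ e^{-i⟨ξ, x⟩} g(ξ) dξ` of the Fourier transform `hatFourier`. -/
def inverseHat (g : EuclideanSpace ℝ (Fin d) → ℂ) (x : EuclideanSpace ℝ (Fin d)) : ℂ :=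
  (((2 * Real.pi) ^ d)⁻¹ : ℝ) * ∫ ξ, Complex.exp (-Complex.I * (⟪ξ, x⟫_ℝ : ℝ)) * g ξ

theorem norm_exp_neg_I_mul (r : ℝ) : ‖Complex.exp (-Complex.I * (r : ℝ))‖ = 1 := by
  rw [show -Complex.I * (r : ℂ) = ((-r : ℝ) : ℂ) * Complex.I by push_cast; ring]
  exact Complex.norm_exp_ofReal_mul_I _

theorem integrable_exp_mul {g : EuclideanSpace ℝ (Fin d) → ℂ} (hg : Integrable g)
    (x : EuclideanSpace ℝ (Fin d)) :
    Integrable fun ξ => Complex.exp (-Complex.I * (⟪ξ, x⟫_ℝ : ℝ)) * g ξ :=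
  hg.bdd_mul (c := 1) (Continuous.aestronglyMeasurable (by fun_prop))
    (Eventually.of_forall fun ξ => (norm_exp_neg_I_mul _).le)

theorem inverseHat_add {f g : EuclideanSpace ℝ (Fin d) → ℂ} (hf : Integrable f)
    (hg : Integrable g) (x : EuclideanSpace ℝ (Fin d)) :
    inverseHat (fun ξ => f ξ + g ξ) x = inverseHat f x + inverseHat g x := by
  simp only [inverseHat, mul_add]
  rw [integral_add (integrable_exp_mul hf x) (integrable_exp_mul hg x), mul_add]

theorem inverseHat_const_mul (r : ℂ) (g : EuclideanSpace ℝ (Fin d) → ℂ)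
    (x : EuclideanSpace ℝ (Fin d)) :
    inverseHat (fun ξ => r * g ξ) x = r * inverseHat g x := by
  simp only [inverseHat, mul_left_comm _ r]
  rw [integral_const_mul]
  ring

theorem inverseHat_sum {ι : Type*} (s : Finset ι) {g : ι → EuclideanSpace ℝ (Fin d) → ℂ}
    (hg : ∀ i, Integrable (g i)) (x : EuclideanSpace ℝ (Fin d)) :
    inverseHat (fun ξ => ∑ i ∈ s, g i ξ) x = ∑ i ∈ s, inverseHat (g i) x := by
  simp only [inverseHat, Finset.mul_sum]
  rw [integral_finsetSum _ fun i _ => integrable_exp_mul (hg i) x, Finset.mul_sum]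

namespace TestFn

/-- Inversion for `𝓕` is transported by the substitution ξ ↦ -(2π)^{-1}ξ, whose Jacobian (2π)^d
cancels the normalising factor. -/
theorem inverseHat_hatFourier (u : TestFn d) (x : EuclideanSpace ℝ (Fin d)) :
    inverseHat (hatFourier u) x = ((u x : ℝ) : ℂ) := by
  have h1 : 𝓕⁻ (𝓕 u.toSchwartz) x = ((u x : ℝ) : ℂ) := by
    rw [FourierTransform.fourierInv_fourier_eq, toSchwartz_apply]
  rw [← h1, SchwartzMap.fourierInv_coe, Real.fourierInv_eq', inverseHat]
  have h2 := Measure.integral_comp_smul (volume : Measure (EuclideanSpace ℝ (Fin d)))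
    (fun v => Complex.exp (((2 * Real.pi * ⟪v, x⟫_ℝ : ℝ) : ℂ) * Complex.I) • 𝓕 u.toSchwartz v)
    (-(2 * Real.pi)⁻¹)
  rw [finrank_euclideanSpace_fin, abs_inv, abs_pow, abs_neg,
    abs_of_pos (by positivity : (0 : ℝ) < (2 * Real.pi)⁻¹), inv_pow, inv_inv] at h2
  have h3 : ∀ ξ : EuclideanSpace ℝ (Fin d), Complex.exp (-Complex.I * (⟪ξ, x⟫_ℝ : ℝ)) *
      hatFourier u ξ = Complex.exp (((2 * Real.pi * ⟪-(2 * Real.pi)⁻¹ • ξ, x⟫_ℝ : ℝ) : ℂ)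
        * Complex.I) • 𝓕 u.toSchwartz (-(2 * Real.pi)⁻¹ • ξ) := by
    intro ξ
    rw [hatFourier_eq, smul_eq_mul]
    congr 2
    rw [real_inner_smul_left]
    have : (Real.pi : ℂ) ≠ 0 := by exact_mod_cast Real.pi_ne_zero
    push_cast
    field_simp
  simp only [h3]
  rw [h2, Complex.real_smul, ← mul_assoc, ← Complex.ofReal_mul, inv_mul_cancel₀ (by positivity),
    Complex.ofReal_one, one_mul]

theorem integrable_hatFourier (u : TestFn d) : Integrable (hatFourier u) := by
  obtain ⟨Φ, hΦ⟩ := u.exists_hat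
  rw [← funext hΦ]
  exact Φ.integrable

theorem continuous_hatFourier (u : TestFn d) : Continuous (hatFourier u) := by
  obtain ⟨Φ, hΦ⟩ := u.exists_hat
  rw [← funext hΦ]
  exact Φ.continuous

theorem integrable_one_add_norm_sq_mul_hatFourier (u : TestFn d) :
    Integrable fun ξ => (1 + ‖ξ‖ ^ 2) * ‖hatFourier u ξ‖ := by
  obtain ⟨Φ, hΦ⟩ := u.exists_hat
  simp only [← hΦ, add_mul, one_mul]
  exact Φ.integrable.norm.add (Φ.integrable_pow_mul volume 2)

theorem integrable_mul_hatFourier (u : TestFn d) {m : EuclideanSpace ℝ (Fin d) → ℂ}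
    (hm : AEStronglyMeasurable m) {C : ℝ} (h : ∀ ξ, ‖m ξ‖ ≤ C * (1 + ‖ξ‖ ^ 2)) :
    Integrable fun ξ => m ξ * hatFourier u ξ := by
  refine (u.integrable_one_add_norm_sq_mul_hatFourier.const_mul C).mono'
    (hm.mul u.continuous_hatFourier.aestronglyMeasurable) (Eventually.of_forall fun ξ => ?_)
  rw [norm_mul, ← mul_assoc]
  exact mul_le_mul_of_nonneg_right (h ξ) (norm_nonneg _)

/-- The partial derivative of a test function as a test function. -/
def partialTest (j : Fin d) (u : TestFn d) : TestFn d where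
  toFun := partialDeriv j u
  contDiff' := (u.contDiff.fderiv_right (m := ((⊤ : ℕ∞) : WithTop ℕ∞)) (by simp)).clm_apply
    contDiff_const
  hasCompactSupport' := u.hasCompactSupport.fderiv_apply ℝ _
  tsupport_subset' := fun _ _ => trivial

theorem coe_partialTest (j : Fin d) (u : TestFn d) : ⇑(partialTest j u) = partialDeriv j u := rfl

theorem toSchwartz_partialTest (j : Fin d) (u : TestFn d) :
    (partialTest j u).toSchwartz
      = LineDeriv.lineDerivOp (EuclideanSpace.single j (1 : ℝ)) u.toSchwartz := by
  ext x
  rw [SchwartzMap.lineDerivOp_apply_eq_fderiv, toSchwartz_apply]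
  have hu : HasFDerivAt u (fderiv ℝ u x) x :=
    ((u.contDiff.differentiable (by simp)) x).hasFDerivAt
  have h1 : HasFDerivAt (fun y => ((u y : ℝ) : ℂ)) (Complex.ofRealCLM.comp (fderiv ℝ u x)) x :=
    Complex.ofRealCLM.hasFDerivAt.comp x hu
  have h2 : ⇑u.toSchwartz = fun y => ((u y : ℝ) : ℂ) := rfl
  rw [h2, h1.fderiv]
  rfl

theorem hatFourier_partialDeriv (j : Fin d) (u : TestFn d) (ξ : EuclideanSpace ℝ (Fin d)) :
    hatFourier (partialDeriv j u) ξ = -Complex.I * (ξ j : ℝ) * hatFourier u ξ := by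
  rw [← coe_partialTest, hatFourier_eq, hatFourier_eq, toSchwartz_partialTest,
    SchwartzMap.fourier_lineDerivOp_eq, _root_.smul_apply,
    SchwartzMap.smulLeftCLM_apply_apply (by fun_prop), EuclideanSpace.inner_single_right]
  have : (Real.pi : ℂ) ≠ 0 := by exact_mod_cast Real.pi_ne_zero
  simp only [PiLp.smul_apply, smul_eq_mul, Complex.real_smul]
  simp
  field_simp

theorem inverseHat_partialDeriv (j : Fin d) (u : TestFn d) (x : EuclideanSpace ℝ (Fin d)) :
    ((partialDeriv j u x : ℝ) : ℂ)
      = inverseHat (fun ξ => -Complex.I * (ξ j : ℝ) * hatFourier u ξ) x := by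
  rw [← coe_partialTest, ← inverseHat_hatFourier, coe_partialTest]
  congr 1
  funext ξ
  exact hatFourier_partialDeriv j u ξ

theorem inverseHat_partialDeriv_partialDeriv (j k : Fin d) (u : TestFn d)
    (x : EuclideanSpace ℝ (Fin d)) :
    ((partialDeriv j (partialDeriv k u) x : ℝ) : ℂ)
      = inverseHat (fun ξ => -((ξ j : ℝ) * (ξ k : ℝ)) * hatFourier u ξ) x := by
  rw [← coe_partialTest k, inverseHat_partialDeriv, coe_partialTest]
  congr 1
  funext ξ
  rw [hatFourier_partialDeriv]
  linear_combination (ξ j : ℂ) * (ξ k : ℝ) * hatFourier u ξ * Complex.I_sq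

theorem inverseHat_translate (u : TestFn d) (x y : EuclideanSpace ℝ (Fin d)) :
    ((u (x + y) : ℝ) : ℂ)
      = inverseHat (fun ξ => Complex.exp (-Complex.I * (⟪ξ, y⟫_ℝ : ℝ)) * hatFourier u ξ) x := by
  rw [← inverseHat_hatFourier, inverseHat, inverseHat]
  congr 2
  funext ξ
  rw [← mul_assoc, ← Complex.exp_add, inner_add_right]
  push_cast
  ring_nf

/-- As v is real, conjugation only flips the exponent, producing the kernel of `inverseHat`;
Parseval is then Fubini. -/
theorem conj_hatFourier (v : TestFn d) (ξ : EuclideanSpace ℝ (Fin d)) :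
    starRingEnd ℂ (hatFourier v ξ)
      = ∫ x, Complex.exp (-Complex.I * (⟪ξ, x⟫_ℝ : ℝ)) * ((v x : ℝ) : ℂ) := by
  rw [hatFourier, ← integral_conj]
  congr 1
  funext x
  rw [map_mul, ← Complex.exp_conj, map_mul, Complex.conj_I, Complex.conj_ofReal,
    Complex.conj_ofReal]

/-- Parseval's identity in the form needed for Fourier multipliers. -/
theorem integral_inverseHat_mul {g : EuclideanSpace ℝ (Fin d) → ℂ} (hg : Integrable g)
    (v : TestFn d) :
    ∫ x, inverseHat g x * ((v x : ℝ) : ℂ)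
      = (((2 * Real.pi) ^ d)⁻¹ : ℝ) * ∫ ξ, g ξ * starRingEnd ℂ (hatFourier v ξ) := by
  simp only [conj_hatFourier, inverseHat, mul_assoc]
  rw [integral_const_mul]
  congr 1
  have hv : Integrable fun x => ((v x : ℝ) : ℂ) :=
    (v.continuous.integrable_of_hasCompactSupport v.hasCompactSupport).ofReal
  have hint : Integrable (Function.uncurry fun x ξ : EuclideanSpace ℝ (Fin d) =>
      Complex.exp (-Complex.I * (⟪ξ, x⟫_ℝ : ℝ)) * (g ξ * ((v x : ℝ) : ℂ)))
      (volume.prod volume) := by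
    have h1 := (hg.mul_prod hv).swap
    refine (h1.bdd_mul (c := 1) (f := fun p : EuclideanSpace ℝ (Fin d) × EuclideanSpace ℝ (Fin d)
      => Complex.exp (-Complex.I * (⟪p.2, p.1⟫_ℝ : ℝ)))
      (Continuous.aestronglyMeasurable (by fun_prop))
      (Eventually.of_forall fun p => (norm_exp_neg_I_mul _).le)).congr
      (Eventually.of_forall fun p => rfl)
  calc ∫ x, (∫ ξ, Complex.exp (-Complex.I * (⟪ξ, x⟫_ℝ : ℝ)) * g ξ) * ((v x : ℝ) : ℂ)
      = ∫ x, ∫ ξ, Complex.exp (-Complex.I * (⟪ξ, x⟫_ℝ : ℝ)) * (g ξ * ((v x : ℝ) : ℂ)) := by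
        congr 1
        funext x
        rw [← integral_mul_const]
        simp only [mul_assoc]
    _ = ∫ ξ, ∫ x, Complex.exp (-Complex.I * (⟪ξ, x⟫_ℝ : ℝ)) * (g ξ * ((v x : ℝ) : ℂ)) :=
        integral_integral_swap hint
    _ = _ := by
        congr 1
        funext ξ
        rw [← integral_const_mul]
        congr 1
        funext x
        ring

end TestFn

end InverseHat

/-! ### The operator as a Fourier multiplier. -/

namespace LevyCharacteristics

variable {d : ℕ} (χ : LevyCharacteristics d)

/-- The integrand `e^{-i⟨ξ, y⟩} - 1 + i⟨ξ, h(y)⟩` of the symbol. -/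
def jumpKernel (ξ y : EuclideanSpace ℝ (Fin d)) : ℂ :=
  Complex.exp (-Complex.I * (⟪ξ, y⟫_ℝ : ℝ)) - 1 + Complex.I * (⟪ξ, χ.h y⟫_ℝ : ℝ)

/-- Taylor's bound covers |s| ≤ 1; for |s| ≥ 1 the trivial bound 2 + |s| is at most 3s². -/
theorem norm_exp_sub_one_add_le (s : ℝ) :
    ‖Complex.exp (-Complex.I * (s : ℝ)) - 1 + Complex.I * (s : ℝ)‖ ≤ 3 * s ^ 2 := by
  have hn : ‖-Complex.I * (s : ℂ)‖ = |s| := by simp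
  rcases le_total |s| 1 with h | h
  · have h1 := Complex.norm_exp_sub_one_sub_id_le (x := -Complex.I * (s : ℝ)) (by rw [hn]; exact h)
    rw [hn, sq_abs] at h1
    have h2 : Complex.exp (-Complex.I * (s : ℝ)) - 1 + Complex.I * (s : ℝ)
        = Complex.exp (-Complex.I * (s : ℝ)) - 1 - -Complex.I * (s : ℝ) := by ring
    rw [h2]
    nlinarith [sq_nonneg s]
  · have h1 : ‖Complex.exp (-Complex.I * (s : ℝ)) - 1 + Complex.I * (s : ℝ)‖ ≤ 1 + 1 + |s| := by
      refine (norm_add_le _ _).trans (add_le_add ((norm_sub_le _ _).trans ?_) (by simp))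
      rw [norm_exp_neg_I_mul, norm_one]
    have h2 : |s| ≤ s ^ 2 := by rw [← sq_abs]; nlinarith
    have h3 : 1 ≤ s ^ 2 := h.trans h2
    linarith

theorem norm_exp_sub_one_le_two (s : ℝ) : ‖Complex.exp (-Complex.I * (s : ℝ)) - 1‖ ≤ 2 := by
  refine (norm_sub_le _ _).trans ?_
  rw [norm_exp_neg_I_mul, norm_one]
  norm_num

theorem integrable_jumpKernel (ξ : EuclideanSpace ℝ (Fin d)) :
    Integrable (χ.jumpKernel ξ) χ.F := by
  refine (χ.integrable_h (-ξ)).congr (Eventually.of_forall fun y => ?_)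
  simp [jumpKernel]

theorem measurable_jumpKernel : Measurable (Function.uncurry χ.jumpKernel) := by
  have := χ.measurable_h
  unfold jumpKernel Function.uncurry
  fun_prop

theorem norm_le_sum_abs (x : EuclideanSpace ℝ (Fin d)) : ‖x‖ ≤ ∑ j, |x j| := by
  conv_lhs => rw [← (EuclideanSpace.basisFun (Fin d) ℝ).sum_repr x]
  refine (norm_sum_le _ _).trans (Finset.sum_le_sum fun j _ => ?_)
  simp [norm_smul]

/-- Separating ξ from y supplies the majorant for Fubini and dominated convergence. Near 0, h(y) = y
and the kernel is quadratically small. Away from 0, the exponential part is bounded on a set of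
finite F-measure, and ‖h‖ has to be shown integrable there because h may be unbounded. -/
theorem exists_jumpKernel_bound : ∃ k : EuclideanSpace ℝ (Fin d) → ℝ, Integrable k χ.F ∧
    ∀ ξ y, ‖χ.jumpKernel ξ y‖ ≤ (1 + ‖ξ‖ ^ 2) * k y := by
  obtain ⟨r, hr, hball⟩ := Metric.eventually_nhds_iff.1 χ.h_eq_id
  -- Radius at most 1, so that min(‖y‖², 1) is ‖y‖² inside the ball and at least ρ² outside.
  set ρ := min r 1 with hρ
  have hρ0 : 0 < ρ := lt_min hr one_pos
  have hρ1 : ρ ≤ 1 := min_le_right _ _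
  set S := {y : EuclideanSpace ℝ (Fin d) | ρ ≤ ‖y‖} with hS
  have hSm : MeasurableSet S := measurableSet_le measurable_const measurable_norm
  have hmin : ∀ y ∈ S, ρ ^ 2 ≤ min (‖y‖ ^ 2) 1 := fun y hy =>
    le_min (pow_le_pow_left₀ hρ0.le hy 2) (pow_le_one₀ hρ0.le hρ1)
  have hSone : IntegrableOn (fun _ => (1 : ℝ)) S χ.F := by
    refine ((χ.integrable_min.const_mul (ρ ^ 2)⁻¹).integrableOn (s := S)).mono'
      aestronglyMeasurable_const ?_
    filter_upwards [ae_restrict_mem hSm] with y hy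
    rw [norm_one, inv_mul_eq_div, one_le_div (by positivity)]
    exact hmin y hy
  -- The kernel at the j-th basis vector is i h_j(y) up to a term bounded by 2, so integrability of
  -- the kernel passes to h_j on S.
  have hcomp : ∀ j : Fin d, IntegrableOn (fun y => |χ.h y j|) S χ.F := by
    intro j
    refine ((((χ.integrable_jumpKernel (EuclideanSpace.single j 1)).norm.integrableOn
      (s := S)).add (hSone.const_mul 2))).mono' ?_ (Eventually.of_forall fun y => ?_)
    · have := χ.measurable_h
      exact (by fun_prop : Measurable fun y => |χ.h y j|).aestronglyMeasurable
    · rw [Real.norm_of_nonneg (abs_nonneg _)]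
      have h1 : ((χ.h y j : ℝ) : ℂ) * Complex.I = χ.jumpKernel (EuclideanSpace.single j 1) y
          - (Complex.exp (-Complex.I * (⟪EuclideanSpace.single j (1 : ℝ), y⟫_ℝ : ℝ)) - 1) := by
        simp only [jumpKernel, EuclideanSpace.inner_single_left, map_one, one_mul]
        ring
      have h2 : |χ.h y j| = ‖((χ.h y j : ℝ) : ℂ) * Complex.I‖ := by simp
      rw [h2, h1]
      refine (norm_sub_le _ _).trans ?_
      simp only [Pi.add_apply, mul_one]
      exact add_le_add le_rfl (norm_exp_sub_one_le_two _)
  have hhn : IntegrableOn (fun y => ‖χ.h y‖) S χ.F := by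
    refine (integrable_finsetSum Finset.univ fun j _ => hcomp j).mono'
      χ.measurable_h.norm.aestronglyMeasurable (Eventually.of_forall fun y => ?_)
    rw [norm_norm]
    exact norm_le_sum_abs _
  refine ⟨fun y => (3 + 2 * (ρ ^ 2)⁻¹) * min (‖y‖ ^ 2) 1 + S.indicator (fun y => ‖χ.h y‖) y,
    (χ.integrable_min.const_mul _).add ((integrable_indicator_iff hSm).2 hhn), fun ξ y => ?_⟩
  have hm0 : 0 ≤ min (‖y‖ ^ 2) 1 := by positivity
  have hi0 : 0 ≤ (ρ ^ 2)⁻¹ := by positivity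
  have hξ := sq_nonneg ‖ξ‖
  beta_reduce
  by_cases hy : y ∈ S
  · rw [Set.indicator_of_mem hy]
    have h1 : ‖χ.jumpKernel ξ y‖ ≤ 2 + ‖ξ‖ * ‖χ.h y‖ := by
      refine (norm_add_le _ _).trans (add_le_add (norm_exp_sub_one_le_two _) ?_)
      simpa using abs_real_inner_le_norm ξ (χ.h y)
    have h2 : ‖ξ‖ ≤ 1 + ‖ξ‖ ^ 2 := by nlinarith [sq_nonneg (‖ξ‖ - 1)]
    have h3 := mul_le_mul_of_nonneg_right h2 (norm_nonneg (χ.h y))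
    have h4 : 1 ≤ (ρ ^ 2)⁻¹ * min (‖y‖ ^ 2) 1 := by
      rw [inv_mul_eq_div, one_le_div (by positivity)]
      exact hmin y hy
    have h5 : 2 ≤ (3 + 2 * (ρ ^ 2)⁻¹) * min (‖y‖ ^ 2) 1 := by linarith
    have h6 : (3 + 2 * (ρ ^ 2)⁻¹) * min (‖y‖ ^ 2) 1
        ≤ (1 + ‖ξ‖ ^ 2) * ((3 + 2 * (ρ ^ 2)⁻¹) * min (‖y‖ ^ 2) 1) :=
      le_mul_of_one_le_left (by linarith) (by linarith)
    linarith
  · rw [Set.indicator_of_notMem hy, add_zero]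
    have hy' : ‖y‖ < ρ := not_le.1 hy
    have hhy : χ.h y = y := hball (by
      rw [dist_zero_right]
      exact hy'.trans_le (min_le_left _ _))
    have hmy : min (‖y‖ ^ 2) 1 = ‖y‖ ^ 2 :=
      min_eq_left (pow_le_one₀ (norm_nonneg _) (hy'.le.trans hρ1))
    rw [hmy, jumpKernel, hhy]
    refine (norm_exp_sub_one_add_le _).trans ?_
    have h3 : ⟪ξ, y⟫_ℝ ^ 2 ≤ ‖ξ‖ ^ 2 * ‖y‖ ^ 2 := by
      rw [← mul_pow, ← sq_abs]
      gcongr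
      exact abs_real_inner_le_norm ξ y
    have h4 : ‖ξ‖ ^ 2 * ‖y‖ ^ 2 ≤ (1 + ‖ξ‖ ^ 2) * ‖y‖ ^ 2 := by nlinarith [sq_nonneg ‖y‖]
    have h5 : 0 ≤ (1 + ‖ξ‖ ^ 2) * (2 * (ρ ^ 2)⁻¹ * ‖y‖ ^ 2) := by positivity
    nlinarith

theorem h_zero : χ.h 0 = 0 := χ.h_eq_id.self_of_nhds

theorem jumpKernel_zero_right (ξ : EuclideanSpace ℝ (Fin d)) : χ.jumpKernel ξ 0 = 0 := by
  simp [jumpKernel, h_zero]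

/-- The Lévy measure is σ-finite away from the origin. -/
theorem exists_sigmaFinite_restrict : ∃ S : Set (EuclideanSpace ℝ (Fin d)), MeasurableSet S ∧
    (∀ y ∉ S, y = 0) ∧ SigmaFinite (χ.F.restrict S) := by
  have h1 : MemLp (fun y : EuclideanSpace ℝ (Fin d) => min (‖y‖ ^ 2) 1) 1 χ.F :=
    memLp_one_iff_integrable.2 χ.integrable_min
  obtain ⟨S, hS, h0, hσ⟩ := (h1.finStronglyMeasurable_of_stronglyMeasurable
    (Continuous.stronglyMeasurable (by fun_prop)) one_ne_zero
    ENNReal.one_ne_top).exists_set_sigmaFinite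
  refine ⟨S, hS, fun y hy => ?_, hσ⟩
  by_contra hne
  have : 0 < min (‖y‖ ^ 2) 1 := lt_min (by positivity) one_pos
  exact this.ne' (h0 y hy)

/-- The integral term of the symbol. -/
def jumpSymbol (ξ : EuclideanSpace ℝ (Fin d)) : ℂ := ∫ y, χ.jumpKernel ξ y ∂χ.F

theorem continuous_jumpSymbol : Continuous χ.jumpSymbol := by
  obtain ⟨k, hk, hb⟩ := χ.exists_jumpKernel_bound
  have hk0 : ∀ y, 0 ≤ k y := fun y => by
    have := (norm_nonneg _).trans (hb 0 y)
    simpa using this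
  rw [continuous_iff_continuousAt]
  intro ξ₀
  refine continuousAt_of_dominated (bound := fun y => (1 + (‖ξ₀‖ + 1) ^ 2) * k y)
    (Eventually.of_forall fun ξ => (χ.integrable_jumpKernel ξ).aestronglyMeasurable) ?_
    (hk.const_mul _) (Eventually.of_forall fun y => ?_)
  · filter_upwards [Metric.ball_mem_nhds ξ₀ one_pos] with ξ hξ
    refine Eventually.of_forall fun y => (hb ξ y).trans ?_
    have hn : ‖ξ‖ ≤ ‖ξ₀‖ + 1 := by
      have := norm_le_norm_add_norm_sub' ξ ξ₀
      rw [Metric.mem_ball, dist_eq_norm] at hξ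
      linarith
    have := hk0 y
    gcongr
  · unfold jumpKernel
    fun_prop

theorem exists_jumpSymbol_bound : ∃ C : ℝ, ∀ ξ, ‖χ.jumpSymbol ξ‖ ≤ C * (1 + ‖ξ‖ ^ 2) := by
  obtain ⟨k, hk, hb⟩ := χ.exists_jumpKernel_bound
  refine ⟨∫ y, k y ∂χ.F, fun ξ => ?_⟩
  refine (norm_integral_le_of_norm_le (hk.const_mul (1 + ‖ξ‖ ^ 2))
    (Eventually.of_forall fun y => hb ξ y)).trans ?_
  rw [integral_const_mul, mul_comm]

theorem inner_eq_sum (x y : EuclideanSpace ℝ (Fin d)) : ⟪x, y⟫_ℝ = ∑ j, x j * y j := by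
  rw [PiLp.inner_apply]
  exact Finset.sum_congr rfl fun j _ => by simp [mul_comm]

theorem norm_coord_le (ξ : EuclideanSpace ℝ (Fin d)) (j : Fin d) :
    ‖((ξ j : ℝ) : ℂ)‖ ≤ 1 + ‖ξ‖ ^ 2 := by
  have h1 : ‖((ξ j : ℝ) : ℂ)‖ ≤ ‖ξ‖ := by
    rw [Complex.norm_real]
    exact PiLp.norm_apply_le ξ j
  nlinarith [sq_nonneg (‖ξ‖ - 1)]

theorem integrable_coord_mul_hat (u : TestFn d) (j : Fin d) :
    Integrable fun ξ : EuclideanSpace ℝ (Fin d) => -Complex.I * (ξ j : ℝ) * hatFourier u ξ :=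
  u.integrable_mul_hatFourier (C := 1) (Continuous.aestronglyMeasurable (by fun_prop)) fun ξ => by
    rw [norm_mul, norm_neg, Complex.norm_I, one_mul, one_mul]
    exact norm_coord_le ξ j

theorem integrable_coord_coord_mul_hat (u : TestFn d) (j k : Fin d) :
    Integrable fun ξ : EuclideanSpace ℝ (Fin d) =>
      -(((ξ j : ℝ) : ℂ) * (ξ k : ℝ)) * hatFourier u ξ :=
  u.integrable_mul_hatFourier (C := 1) (Continuous.aestronglyMeasurable (by fun_prop)) fun ξ => by
    rw [norm_neg, norm_mul, one_mul, Complex.norm_real, Complex.norm_real]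
    have h1 := PiLp.norm_apply_le ξ j
    have h2 := PiLp.norm_apply_le ξ k
    have h3 := mul_le_mul h1 h2 (norm_nonneg _) (norm_nonneg _)
    linarith

/-- Translation contributes e^{-i⟨ξ,y⟩} and each -h_j ∂_j contributes i ξ_j h_j; together with -1
these are the jump kernel. -/
theorem increment_eq_inverseHat (u : TestFn d) (x y : EuclideanSpace ℝ (Fin d)) :
    ((u (x + y) - u x - ∑ j, partialDeriv j u x * χ.h y j : ℝ) : ℂ)
      = inverseHat (fun ξ => χ.jumpKernel ξ y * hatFourier u ξ) x := by
  have h1 := u.integrable_hatFourier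
  have h2 := integrable_exp_mul h1 y
  have h3 := inverseHat_sum Finset.univ
    (fun j : Fin d => (integrable_coord_mul_hat u j).const_mul (-((χ.h y j : ℝ) : ℂ))) x
  simp only [inverseHat_const_mul, ← TestFn.inverseHat_partialDeriv] at h3
  have e : (fun ξ => χ.jumpKernel ξ y * hatFourier u ξ)
      = fun ξ => (Complex.exp (-Complex.I * (⟪ξ, y⟫_ℝ : ℝ)) * hatFourier u ξ
        + (-1) * hatFourier u ξ)
        + ∑ j, -((χ.h y j : ℝ) : ℂ) * (-Complex.I * (ξ j : ℝ) * hatFourier u ξ) := by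
    funext ξ
    have : ∑ j, -((χ.h y j : ℝ) : ℂ) * (-Complex.I * (ξ j : ℝ) * hatFourier u ξ)
        = Complex.I * (⟪ξ, χ.h y⟫_ℝ : ℝ) * hatFourier u ξ := by
      rw [inner_eq_sum, Complex.ofReal_sum, Finset.mul_sum, Finset.sum_mul]
      refine Finset.sum_congr rfl fun j _ => ?_
      push_cast
      ring
    rw [this, jumpKernel]
    ring
  rw [e, inverseHat_add (h2.fun_add (h1.const_mul (-1))) (integrable_finsetSum _ fun j _ =>
    (integrable_coord_mul_hat u j).const_mul _), inverseHat_add h2 (h1.const_mul (-1)), h3,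
    inverseHat_const_mul, TestFn.inverseHat_hatFourier, ← TestFn.inverseHat_translate]
  push_cast
  rw [sub_eq_add_neg _ (∑ j, _), ← Finset.sum_neg_distrib, neg_one_mul, ← sub_eq_add_neg]
  congr 1
  exact Finset.sum_congr rfl fun j _ => by ring

/-- Integrate the pointwise multiplier identity over y and exchange with the ξ-integral. F may carry
arbitrary mass at the origin, but the kernel vanishes there, so Fubini is applied on a σ-finite part
of F. -/
theorem jump_eq_inverseHat (u : TestFn d) (x : EuclideanSpace ℝ (Fin d)) :
    ((∫ y, (u (x + y) - u x - ∑ j, partialDeriv j u x * χ.h y j) ∂χ.F : ℝ) : ℂ)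
      = inverseHat (fun ξ => χ.jumpSymbol ξ * hatFourier u ξ) x := by
  obtain ⟨S, hS, hS0, hσ⟩ := χ.exists_sigmaFinite_restrict
  obtain ⟨k, hk, hb⟩ := χ.exists_jumpKernel_bound
  rw [← integral_complex_ofReal]
  simp only [increment_eq_inverseHat]
  have e1 : ∀ ξ, χ.jumpSymbol ξ = ∫ y in S, χ.jumpKernel ξ y ∂χ.F := fun ξ =>
    (setIntegral_eq_integral_of_forall_compl_eq_zero fun y hy => by
      rw [hS0 y hy, jumpKernel_zero_right]).symm
  rw [← setIntegral_eq_integral_of_forall_compl_eq_zero (s := S) fun y hy => by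
    simp [hS0 y hy, jumpKernel_zero_right, inverseHat]]
  simp only [inverseHat, e1]
  rw [integral_const_mul]
  congr 1
  have hint : Integrable (Function.uncurry fun y ξ : EuclideanSpace ℝ (Fin d) =>
      Complex.exp (-Complex.I * (⟪ξ, x⟫_ℝ : ℝ)) * (χ.jumpKernel ξ y * hatFourier u ξ))
      ((χ.F.restrict S).prod volume) := by
    refine ((hk.restrict (s := S)).mul_prod u.integrable_one_add_norm_sq_mul_hatFourier).mono' ?_ ?_
    · have h1 := χ.measurable_jumpKernel.comp measurable_swap
      have h2 := u.continuous_hatFourier.measurable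
      have h3 : Measurable fun p : EuclideanSpace ℝ (Fin d) × EuclideanSpace ℝ (Fin d) =>
          χ.jumpKernel p.2 p.1 := h1
      unfold Function.uncurry
      exact Measurable.aestronglyMeasurable (by fun_prop)
    · refine Eventually.of_forall fun p => ?_
      simp only [Function.uncurry]
      rw [norm_mul, norm_exp_neg_I_mul, one_mul, norm_mul]
      refine (mul_le_mul_of_nonneg_right (hb p.2 p.1) (norm_nonneg _)).trans (le_of_eq ?_)
      ring
  rw [integral_integral_swap hint]
  congr 1
  funext ξ
  rw [integral_const_mul, integral_mul_const]

theorem symbol_eq_sub (ξ : EuclideanSpace ℝ (Fin d)) :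
    χ.symbol ξ = (1 / 2 : ℂ) * ((∑ j, ∑ k, ξ j * χ.σ j k * ξ k : ℝ) : ℂ)
      + Complex.I * (⟪ξ, χ.b⟫_ℝ : ℝ) - χ.jumpSymbol ξ := rfl

theorem continuous_symbol : Continuous χ.symbol := by
  simp only [funext χ.symbol_eq_sub]
  have := χ.continuous_jumpSymbol
  fun_prop

/-- The operator `𝒜` is the Fourier multiplier with symbol `A`. -/
theorem operator_eq_inverseHat (u : TestFn d) (x : EuclideanSpace ℝ (Fin d)) :
    ((χ.operator u x : ℝ) : ℂ) = inverseHat (fun ξ => χ.symbol ξ * hatFourier u ξ) x := by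
  have hσ := inverseHat_sum Finset.univ (fun j : Fin d => integrable_finsetSum Finset.univ
    fun k _ => (integrable_coord_coord_mul_hat u j k).const_mul (((χ.σ j k : ℝ) : ℂ))) x
  simp only [fun j : Fin d => inverseHat_sum Finset.univ (fun k => (integrable_coord_coord_mul_hat
    u j k).const_mul (((χ.σ j k : ℝ) : ℂ))) x, inverseHat_const_mul,
    ← TestFn.inverseHat_partialDeriv_partialDeriv] at hσ
  have hb := inverseHat_sum Finset.univ
    (fun j : Fin d => (integrable_coord_mul_hat u j).const_mul (((χ.b j : ℝ) : ℂ))) x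
  simp only [inverseHat_const_mul, ← TestFn.inverseHat_partialDeriv] at hb
  obtain ⟨C, hC⟩ := χ.exists_jumpSymbol_bound
  have hJi := u.integrable_mul_hatFourier χ.continuous_jumpSymbol.aestronglyMeasurable hC
  have e : (fun ξ => χ.symbol ξ * hatFourier u ξ) = fun ξ =>
      ((-(1 / 2 : ℂ)) * (∑ j, ∑ k, ((χ.σ j k : ℝ) : ℂ)
        * (-(((ξ j : ℝ) : ℂ) * (ξ k : ℝ)) * hatFourier u ξ))
      + (-1) * (∑ j, ((χ.b j : ℝ) : ℂ) * (-Complex.I * (ξ j : ℝ) * hatFourier u ξ)))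
      + (-1) * (χ.jumpSymbol ξ * hatFourier u ξ) := by
    funext ξ
    have h1 : ∑ j, ∑ k, ((χ.σ j k : ℝ) : ℂ) * (-(((ξ j : ℝ) : ℂ) * (ξ k : ℝ)) * hatFourier u ξ)
        = -((∑ j, ∑ k, ξ j * χ.σ j k * ξ k : ℝ) : ℂ) * hatFourier u ξ := by
      push_cast
      rw [← Finset.sum_neg_distrib, Finset.sum_mul]
      refine Finset.sum_congr rfl fun j _ => ?_
      rw [← Finset.sum_neg_distrib, Finset.sum_mul]
      refine Finset.sum_congr rfl fun k _ => ?_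
      ring
    have h2 : ∑ j, ((χ.b j : ℝ) : ℂ) * (-Complex.I * (ξ j : ℝ) * hatFourier u ξ)
        = -(Complex.I * (⟪ξ, χ.b⟫_ℝ : ℝ)) * hatFourier u ξ := by
      rw [inner_eq_sum, Complex.ofReal_sum, Finset.mul_sum, ← Finset.sum_neg_distrib,
        Finset.sum_mul]
      refine Finset.sum_congr rfl fun j _ => ?_
      push_cast
      ring
    rw [h1, h2, symbol_eq_sub]
    ring
  have i1 : Integrable fun ξ : EuclideanSpace ℝ (Fin d) => (-(1 / 2 : ℂ)) * (∑ j, ∑ k,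
      ((χ.σ j k : ℝ) : ℂ) * (-(((ξ j : ℝ) : ℂ) * (ξ k : ℝ)) * hatFourier u ξ)) :=
    (integrable_finsetSum _ fun j _ => integrable_finsetSum _ fun k _ =>
      (integrable_coord_coord_mul_hat u j k).const_mul _).const_mul _
  have i2 : Integrable fun ξ : EuclideanSpace ℝ (Fin d) =>
      (-1 : ℂ) * (∑ j, ((χ.b j : ℝ) : ℂ) * (-Complex.I * (ξ j : ℝ) * hatFourier u ξ)) :=
    (integrable_finsetSum _ fun j _ => (integrable_coord_mul_hat u j).const_mul _).const_mul _
  rw [e, inverseHat_add (i1.fun_add i2) (hJi.const_mul (-1)), inverseHat_add i1 i2,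
    inverseHat_const_mul, inverseHat_const_mul, inverseHat_const_mul, hσ, hb,
    ← jump_eq_inverseHat, operator, generator]
  push_cast
  ring

theorem integrable_symbol_mul_hatFourier (u : TestFn d) :
    Integrable fun ξ => χ.symbol ξ * hatFourier u ξ := by
  obtain ⟨C, hC⟩ := χ.exists_jumpSymbol_bound
  set M := (1 / 2) * ∑ j, ∑ k, |χ.σ j k| with hM
  refine u.integrable_mul_hatFourier (C := M + ‖χ.b‖ + C)
    χ.continuous_symbol.aestronglyMeasurable fun ξ => ?_
  rw [symbol_eq_sub]
  refine (norm_sub_le _ _).trans ?_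
  have h1 : ‖(1 / 2 : ℂ) * ((∑ j, ∑ k, ξ j * χ.σ j k * ξ k : ℝ) : ℂ)‖ ≤ M * (1 + ‖ξ‖ ^ 2) := by
    rw [norm_mul, Complex.norm_real, hM, mul_assoc]
    norm_num
    rw [Finset.sum_mul]
    refine (Finset.abs_sum_le_sum_abs _ _).trans (Finset.sum_le_sum fun j _ => ?_)
    rw [Finset.sum_mul]
    refine (Finset.abs_sum_le_sum_abs _ _).trans (Finset.sum_le_sum fun k _ => ?_)
    rw [abs_mul, abs_mul]
    have hj : |ξ j| ≤ ‖ξ‖ := by simpa using PiLp.norm_apply_le ξ j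
    have hk : |ξ k| ≤ ‖ξ‖ := by simpa using PiLp.norm_apply_le ξ k
    calc |ξ j| * |χ.σ j k| * |ξ k| ≤ ‖ξ‖ * |χ.σ j k| * ‖ξ‖ := by gcongr
      _ ≤ |χ.σ j k| * (1 + ‖ξ‖ ^ 2) := by nlinarith [abs_nonneg (χ.σ j k)]
  have h2 : ‖Complex.I * ((⟪ξ, χ.b⟫_ℝ : ℝ) : ℂ)‖ ≤ ‖χ.b‖ * (1 + ‖ξ‖ ^ 2) := by
    rw [norm_mul, Complex.norm_I, one_mul, Complex.norm_real]
    refine (abs_real_inner_le_norm _ _).trans ?_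
    rw [mul_comm]
    refine mul_le_mul_of_nonneg_left ?_ (norm_nonneg _)
    nlinarith [sq_nonneg (‖ξ‖ - 1)]
  have h3 := (norm_add_le ((1 / 2 : ℂ) * ((∑ j, ∑ k, ξ j * χ.σ j k * ξ k : ℝ) : ℂ))
    (Complex.I * ((⟪ξ, χ.b⟫_ℝ : ℝ) : ℂ))).trans (add_le_add h1 h2)
  linarith [hC ξ]

/-! ### Continuity, extension and the Gårding inequality. -/

/-- The bilinear form of `𝒜` in terms of the symbol. -/
theorem integral_operator_mul (u v : TestFn d) :
    ((∫ x, χ.operator u x * v x : ℝ) : ℂ) = (((2 * Real.pi) ^ d)⁻¹ : ℝ) *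
      ∫ ξ, χ.symbol ξ * hatFourier u ξ * starRingEnd ℂ (hatFourier v ξ) := by
  rw [← TestFn.integral_inverseHat_mul (χ.integrable_symbol_mul_hatFourier u) v,
    ← integral_complex_ofReal]
  simp only [Complex.ofReal_mul, operator_eq_inverseHat]

theorem integrable_weight_mul (u v : TestFn d) :
    Integrable fun ξ => (1 + (χ.symbol ξ).re) * (‖hatFourier u ξ‖ * ‖hatFourier v ξ‖) := by
  refine (χ.integrable_energy u v).norm.congr (Eventually.of_forall fun ξ => ?_)
  simp only [norm_mul, RCLike.norm_conj, Complex.norm_real]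
  rw [Real.norm_of_nonneg (by linarith [χ.symbol_re_nonneg ξ])]

theorem norm_toEnergy_sq (u : TestFn d) :
    ‖χ.toEnergy u‖ ^ 2 = ∫ ξ, (1 + (χ.symbol ξ).re) * ‖hatFourier u ξ‖ ^ 2 := by
  rw [toEnergy, UniformSpace.Completion.norm_coe, norm_sq_preEnergy]
  rfl

/-- The Cauchy-Schwarz inequality for the weighted `L²` norm. -/
theorem integral_weight_mul_le (u v : TestFn d) :
    ∫ ξ, (1 + (χ.symbol ξ).re) * (‖hatFourier u ξ‖ * ‖hatFourier v ξ‖)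
      ≤ ‖χ.toEnergy u‖ * ‖χ.toEnergy v‖ := by
  set Q := ∫ ξ, (1 + (χ.symbol ξ).re) * (‖hatFourier u ξ‖ * ‖hatFourier v ξ‖) with hQ
  have hsq : ∀ w : TestFn d, ‖χ.toEnergy w‖ ^ 2
      = ∫ ξ, (1 + (χ.symbol ξ).re) * (‖hatFourier w ξ‖ * ‖hatFourier w ξ‖) := fun w => by
    rw [norm_toEnergy_sq]
    simp only [sq]
  -- This quadratic in t is the integral of (1 + Re A)(t|û| - |v̂|)², so its discriminant is
  -- nonpositive.
  have h1 : ∀ t : ℝ, 0 ≤ ‖χ.toEnergy u‖ ^ 2 * (t * t) + (-2 * Q) * t + ‖χ.toEnergy v‖ ^ 2 := by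
    intro t
    have i1 := (χ.integrable_weight_mul u u).const_mul (t * t)
    have i2 := (χ.integrable_weight_mul u v).const_mul (-2 * t)
    have h2 : ‖χ.toEnergy u‖ ^ 2 * (t * t) + (-2 * Q) * t + ‖χ.toEnergy v‖ ^ 2
        = ∫ ξ, (t * t * ((1 + (χ.symbol ξ).re) * (‖hatFourier u ξ‖ * ‖hatFourier u ξ‖))
          + -2 * t * ((1 + (χ.symbol ξ).re) * (‖hatFourier u ξ‖ * ‖hatFourier v ξ‖)))
          + (1 + (χ.symbol ξ).re) * (‖hatFourier v ξ‖ * ‖hatFourier v ξ‖) := by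
      rw [integral_add (i1.fun_add i2) (χ.integrable_weight_mul v v), integral_add i1 i2,
        integral_const_mul, integral_const_mul, hsq, hsq]
      ring
    rw [h2]
    refine integral_nonneg fun ξ => ?_
    have h3 : (t * t * ((1 + (χ.symbol ξ).re) * (‖hatFourier u ξ‖ * ‖hatFourier u ξ‖))
          + -2 * t * ((1 + (χ.symbol ξ).re) * (‖hatFourier u ξ‖ * ‖hatFourier v ξ‖)))
          + (1 + (χ.symbol ξ).re) * (‖hatFourier v ξ‖ * ‖hatFourier v ξ‖)
        = (1 + (χ.symbol ξ).re) * (t * ‖hatFourier u ξ‖ - ‖hatFourier v ξ‖) ^ 2 := by ring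
    change 0 ≤ (t * t * ((1 + (χ.symbol ξ).re) * (‖hatFourier u ξ‖ * ‖hatFourier u ξ‖))
          + -2 * t * ((1 + (χ.symbol ξ).re) * (‖hatFourier u ξ‖ * ‖hatFourier v ξ‖)))
          + (1 + (χ.symbol ξ).re) * (‖hatFourier v ξ‖ * ‖hatFourier v ξ‖)
    rw [h3]
    exact mul_nonneg (by linarith [χ.symbol_re_nonneg ξ]) (sq_nonneg _)
  have h2 := discrim_le_zero h1
  rw [discrim] at h2
  refine le_of_sq_le_sq ?_ (by positivity)
  rw [mul_pow]
  linarith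

/-- The bound on Im A enters the estimates only through this inequality: it lets the energy weight
control the whole symbol. -/
theorem norm_symbol_le {c : ℝ} (hc : ∀ ξ, |(χ.symbol ξ).im| ≤ c * (1 + (χ.symbol ξ).re))
    (ξ : EuclideanSpace ℝ (Fin d)) : ‖χ.symbol ξ‖ ≤ (1 + c) * (1 + (χ.symbol ξ).re) := by
  have h1 := Complex.norm_le_abs_re_add_abs_im (χ.symbol ξ)
  rw [abs_of_nonneg (χ.symbol_re_nonneg ξ)] at h1
  linarith [hc ξ]

theorem integrable_symbol_form (u v : TestFn d) :
    Integrable fun ξ => χ.symbol ξ * hatFourier u ξ * starRingEnd ℂ (hatFourier v ξ) := by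
  obtain ⟨Ψ, hΨ⟩ := v.exists_hat
  obtain ⟨C, -, hC⟩ := Ψ.decay 0 0
  refine (χ.integrable_symbol_mul_hatFourier u).mul_bdd (c := C)
    (Complex.continuous_conj.comp v.continuous_hatFourier).aestronglyMeasurable
    (Eventually.of_forall fun ξ => ?_)
  rw [RCLike.norm_conj, ← hΨ]
  simpa using hC ξ

/-- The sesquilinear form `(2π)^{-d} ∫ A(ξ) û(ξ) conj(v̂(ξ)) dξ` of the symbol. -/
def symbolForm (u v : TestFn d) : ℂ :=
  (((2 * Real.pi) ^ d)⁻¹ : ℝ) *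
    ∫ ξ, χ.symbol ξ * hatFourier u ξ * starRingEnd ℂ (hatFourier v ξ)

theorem integral_operator_mul_eq (u v : TestFn d) :
    ∫ x, χ.operator u x * v x = (χ.symbolForm u v).re := by
  rw [symbolForm, ← χ.integral_operator_mul u v, Complex.ofReal_re]

theorem norm_symbolForm_le {c : ℝ} (hc : ∀ ξ, |(χ.symbol ξ).im| ≤ c * (1 + (χ.symbol ξ).re))
    (u v : TestFn d) :
    ‖χ.symbolForm u v‖
      ≤ ((2 * Real.pi) ^ d)⁻¹ * (1 + c) * ‖χ.toEnergy u‖ * ‖χ.toEnergy v‖ := by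
  -- No sign of c is assumed; the symbol bound at ξ = 0 provides it.
  have hc0 : 0 ≤ 1 + c := by
    have h1 := (norm_nonneg _).trans (χ.norm_symbol_le hc 0)
    have h2 := χ.symbol_re_nonneg 0
    exact nonneg_of_mul_nonneg_left h1 (by linarith)
  rw [symbolForm, norm_mul, Complex.norm_real, Real.norm_of_nonneg (by positivity), mul_assoc,
    mul_assoc]
  refine mul_le_mul_of_nonneg_left ?_ (by positivity)
  refine (norm_integral_le_of_norm_le ((χ.integrable_weight_mul u v).const_mul (1 + c))
    (Eventually.of_forall fun ξ => ?_)).trans ?_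
  · rw [norm_mul, norm_mul, RCLike.norm_conj, mul_assoc, ← mul_assoc (1 + c)]
    exact mul_le_mul_of_nonneg_right (χ.norm_symbol_le hc ξ) (by positivity)
  · rw [integral_const_mul]
    exact mul_le_mul_of_nonneg_left (χ.integral_weight_mul_le u v) hc0

theorem symbolForm_add_left (u u' v : TestFn d) :
    χ.symbolForm (u + u') v = χ.symbolForm u v + χ.symbolForm u' v := by
  simp only [symbolForm, TestFn.hatFourier_add, mul_add, add_mul]
  rw [integral_add (χ.integrable_symbol_form u v) (χ.integrable_symbol_form u' v), mul_add]

theorem symbolForm_add_right (u v v' : TestFn d) :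
    χ.symbolForm u (v + v') = χ.symbolForm u v + χ.symbolForm u v' := by
  simp only [symbolForm, TestFn.hatFourier_add, map_add, mul_add]
  rw [integral_add (χ.integrable_symbol_form u v) (χ.integrable_symbol_form u v'), mul_add]

theorem symbolForm_smul_left (r : ℝ) (u v : TestFn d) :
    χ.symbolForm (r • u) v = r * χ.symbolForm u v := by
  simp only [symbolForm, TestFn.hatFourier_smul, mul_left_comm _ (r : ℂ), mul_assoc (r : ℂ)]
  rw [integral_const_mul]
  ring

theorem symbolForm_smul_right (r : ℝ) (u v : TestFn d) :
    χ.symbolForm u (r • v) = r * χ.symbolForm u v := by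
  simp only [symbolForm, TestFn.hatFourier_smul, map_mul, Complex.conj_ofReal,
    mul_left_comm _ (r : ℂ)]
  rw [integral_const_mul]
  ring

theorem norm_toL2_toEnergy_sq (u : TestFn d) :
    ‖χ.toL2 (χ.toEnergy u)‖ ^ 2
      = ((2 * Real.pi) ^ d)⁻¹ * ∫ ξ, ‖hatFourier u ξ‖ ^ 2 := by
  have h1 : ‖χ.toL2 (χ.toEnergy u)‖ ^ 2 = ∫ x, u x * u x := by
    rw [toL2_toEnergy, ← real_inner_self_eq_norm_sq, L2.inner_def]
    refine integral_congr_ae ?_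
    filter_upwards [MemLp.coeFn_toLp (u.continuous.memLp_of_hasCompactSupport
      (p := 2) (μ := volume) u.hasCompactSupport)] with x hx
    rw [hx, real_inner_self_eq_norm_sq, Real.norm_eq_abs, sq_abs, sq]
  have h2 := TestFn.integral_inverseHat_mul u.integrable_hatFourier u
  simp only [TestFn.inverseHat_hatFourier, Complex.mul_conj, Complex.normSq_eq_norm_sq,
    ← Complex.ofReal_mul, integral_complex_ofReal] at h2
  rw [h1]
  exact_mod_cast h2

/-- On the diagonal û conj(û) = |û|² is real, so Im A drops out of the real part. Writing Re A = (1
+ Re A) - 1 splits the integral into the energy norm and, by Plancherel, the L² norm. -/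
theorem symbolForm_self_re (u : TestFn d) :
    (χ.symbolForm u u).re
      = ((2 * Real.pi) ^ d)⁻¹ * ‖χ.toEnergy u‖ ^ 2 - ‖χ.toL2 (χ.toEnergy u)‖ ^ 2 := by
  have i1 := χ.integrable_weight_mul u u
  have i2 : Integrable fun ξ => ‖hatFourier u ξ‖ ^ 2 := by
    refine i1.mono' (u.continuous_hatFourier.norm.pow 2).aestronglyMeasurable
      (Eventually.of_forall fun ξ => ?_)
    rw [Real.norm_of_nonneg (by positivity), sq]
    exact le_mul_of_one_le_left (by positivity) (by linarith [χ.symbol_re_nonneg ξ])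
  simp only [← sq] at i1
  rw [symbolForm, Complex.re_ofReal_mul, norm_toL2_toEnergy_sq, norm_toEnergy_sq, ← mul_sub,
    ← integral_sub i1 i2]
  congr 1
  have h := integral_re (χ.integrable_symbol_form u u)
  refine Eq.trans h.symm (integral_congr_ae (Eventually.of_forall fun ξ => ?_))
  change (χ.symbol ξ * hatFourier u ξ * starRingEnd ℂ (hatFourier u ξ)).re = _
  rw [mul_assoc, Complex.mul_conj, Complex.re_mul_ofReal, Complex.normSq_eq_norm_sq]
  ring

theorem denseRange_toEnergy : DenseRange χ.toEnergy :=
  UniformSpace.Completion.denseRange_coe (α := χ.PreEnergy)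

/-- The bilinear form of `𝒜` on `H^{Re A}` exists. -/
theorem exists_isBilinearFormOf {c : ℝ}
    (hc : ∀ ξ, |(χ.symbol ξ).im| ≤ c * (1 + (χ.symbol ξ).re)) : ∃ a, χ.IsBilinearFormOf a := by
  let b : χ.PreEnergy →ₗ[ℝ] χ.PreEnergy →ₗ[ℝ] ℝ :=
    LinearMap.mk₂ ℝ (fun u v => (χ.symbolForm (χ.toTest u) (χ.toTest v)).re)
      (fun u u' v => by rw [map_add, symbolForm_add_left, Complex.add_re])
      (fun r u v => by rw [map_smul, symbolForm_smul_left, Complex.re_ofReal_mul, smul_eq_mul])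
      (fun u v v' => by rw [map_add, symbolForm_add_right, Complex.add_re])
      (fun r u v => by rw [map_smul, symbolForm_smul_right, Complex.re_ofReal_mul, smul_eq_mul])
  let B : χ.PreEnergy →L[ℝ] χ.PreEnergy →L[ℝ] ℝ :=
    b.mkContinuous₂ (((2 * Real.pi) ^ d)⁻¹ * (1 + c)) fun u v => by
      have h1 := (Complex.abs_re_le_norm _).trans
        (χ.norm_symbolForm_le hc (χ.toTest u) (χ.toTest v))
      have h2 : ∀ u : χ.PreEnergy, ‖χ.toEnergy (χ.toTest u)‖ = ‖u‖ := fun u =>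
        UniformSpace.Completion.norm_coe _
      rwa [h2, h2] at h1
  let e := UniformSpace.Completion.toComplL (𝕜 := ℝ) (E := χ.PreEnergy)
  have he : DenseRange e := UniformSpace.Completion.denseRange_coe
  have hi : IsUniformInducing e := UniformSpace.Completion.isUniformInducing_coe _
  -- The extension is made one variable at a time, with a flip to reach the second.
  refine ⟨((B.extend e).flip.extend e).flip, fun u v => ?_⟩
  rw [integral_operator_mul_eq]
  have h1 : ((B.extend e).flip.extend e) (e (χ.toTest.symm v)) = (B.extend e).flip (χ.toTest.symm v) :=
    ContinuousLinearMap.extend_eq _ he hi _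
  have h2 : (B.extend e) (e (χ.toTest.symm u)) = B (χ.toTest.symm u) :=
    ContinuousLinearMap.extend_eq _ he hi _
  change ((B.extend e).flip.extend e) (e (χ.toTest.symm v)) (e (χ.toTest.symm u)) = _
  rw [h1, ContinuousLinearMap.flip_apply, h2]
  rfl

theorem isBilinearFormOf_unique {a a' : χ.EnergySpace →L[ℝ] χ.EnergySpace →L[ℝ] ℝ}
    (ha : χ.IsBilinearFormOf a) (ha' : χ.IsBilinearFormOf a') : a = a' := by
  refine ContinuousLinearMap.ext fun x => ContinuousLinearMap.ext fun y => ?_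
  refine χ.denseRange_toEnergy.induction_on (p := fun y => a x y = a' x y) y
    (isClosed_eq (by fun_prop) (by fun_prop)) fun v => ?_
  refine χ.denseRange_toEnergy.induction_on
    (p := fun x => a x (χ.toEnergy v) = a' x (χ.toEnergy v)) x
    (isClosed_eq (by fun_prop) (by fun_prop)) fun u => ?_
  exact (ha u v).trans (ha' u v).symm

/-- The Gårding inequality. -/
theorem gardingInequality {a : χ.EnergySpace →L[ℝ] χ.EnergySpace →L[ℝ] ℝ}
    (ha : χ.IsBilinearFormOf a) : GardingInequality χ.toL2 a := by
  -- Both constants are read off from `symbolForm_self_re`, where equality holds on test functions.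
  refine ⟨((2 * Real.pi) ^ d)⁻¹, by positivity, 1, zero_le_one, fun x => ?_⟩
  refine χ.denseRange_toEnergy.induction_on
    (p := fun x => a x x ≥ ((2 * Real.pi) ^ d)⁻¹ * ‖x‖ ^ 2 - 1 * ‖χ.toL2 x‖ ^ 2) x
    (isClosed_le (by fun_prop) (by fun_prop)) fun u => ?_
  rw [ha u u, integral_operator_mul_eq, symbolForm_self_re, one_mul]

/-- The range contains the classes of test functions, which are dense in L². This density lets an
arbitrary initial value g be approximated from the energy space. -/
theorem denseRange_toL2 : DenseRange χ.toL2 := by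
  refine (Lp.dense_hasCompactSupport_contDiff (F := ℝ) (p := 2)
    (μ := (volume : Measure (EuclideanSpace ℝ (Fin d)))) ENNReal.ofNat_ne_top).mono ?_
  rintro f ⟨g, hfg, hg, hg'⟩
  refine ⟨χ.toEnergy ⟨g, hg', hg, fun _ _ => trivial⟩, ?_⟩
  rw [toL2_toEnergy]
  exact Lp.ext ((MemLp.coeFn_toLp _).trans hfg.symm)

end LevyCharacteristics

end

theorem mainTheorem2 {d : ℕ} {Ω : Type*} [MeasurableSpace Ω] (P : Measure Ω)
    [IsProbabilityMeasure P] (L : ℝ≥0 → Ω → EuclideanSpace ℝ (Fin d)) (hL : IsLevyProcess L P)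
    (χ : LevyCharacteristics d) (hχ : χ.IsCharacteristicsOf L P)
    (hA : ∃ c : ℝ, ∀ ξ, |(χ.symbol ξ).im| ≤ c * (1 + (χ.symbol ξ).re)) :
    (∃ C : ℝ, ∀ u v : TestFn d,
      |∫ x, χ.operator u x * v x| ≤ C * ‖χ.toEnergy u‖ * ‖χ.toEnergy v‖) ∧
    (∃! a, χ.IsBilinearFormOf a) ∧
    ∀ a, χ.IsBilinearFormOf a →
      GardingInequality χ.toL2 a ∧
      ∀ T > 0, ∀ (f : Lp (StrongDual ℝ χ.EnergySpace) 2 (volume.restrict (Set.Ioo 0 T)))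
        (g : Lp ℝ 2 (volume : Measure (EuclideanSpace ℝ (Fin d)))),
        ∃! u, IsParabolicSolution χ.toL2 a T f g u := by
  obtain ⟨c, hc⟩ := hA
  refine ⟨⟨((2 * Real.pi) ^ d)⁻¹ * (1 + c), fun u v => ?_⟩, ?_, fun a ha =>
    ⟨χ.gardingInequality ha, fun T hT f g =>
      existsUnique_isParabolicSolution χ.denseRange_toL2 (χ.gardingInequality ha) hT f g⟩⟩
  · rw [χ.integral_operator_mul_eq]
    exact (Complex.abs_re_le_norm _).trans (χ.norm_symbolForm_le hc u v)
  · obtain ⟨a, ha⟩ := χ.exists_isBilinearFormOf hc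
    exact ⟨a, ha, fun a' ha' => χ.isBilinearFormOf_unique ha' ha⟩
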